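/- **Setting.** Let $\mathcal S\subseteq\mathbb R_+^k$ be a subsemigroup containing $0$ such that for all $s\in\mathcal S-\mathcal S$ both $s_+=(\max\{s_1,0\},\dots,\max\{s_k,0\})$ and $s_-=s_+-s$ lie in $\mathcal S$. Let $\mathcal A$ be a unital $C^*$-algebra. A *correspondence* over $\mathcal A$ is a (right) Hilbert $\mathcal A$-module with a left action of $\mathcal A$ given by a $*$-homomorphism into the adjointable operators; it is *unital* if $1\in\mathcal A$ acts on the left as the identity. A *product system* over $\mathcal S$ is a family $X=\{X(s)\}_{s\in\mathcal S}$ of correspondences over $\mathcal A$ with an associative multiplication $X(s)\times X(t)\to X(s+t)$ such that $X(0)=\mathcal A$, multiplication by $X(0)$ is given by the left and right actions, and for $s,t\neq 0$ the multiplication extends to an isomorphism of correspondences from the balanced tensor product $X(s)\otimes_{\mathcal A}X(t)$ onto $X(s+t)$. If $\mathcal A$ is a $W^*$-algebra, a *product system of $W^*$-correspondences* is defined in the same way, except that all $X(s)$ are self-dual with normal left action and $X(s)\otimes_{\mathcal A}X(t)$ is replaced by its self-dual extension. A *representation* $(\sigma,T)$ of $X$ on a Hilbert space $H$ consists of a nondegenerate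 $*$-homomorphism $\sigma:\mathcal A\to B(H)$ and completely contractive linear maps $T_s:X(s)\to B(H)$, $s\in\mathcal S$, such that $T_0=\sigma$, $T_s(xa)=T_s(x)\sigma(a)$, $T_s(ax)=\sigma(a)T_s(x)$ and $T_{s+t}(xy)=T_s(x)T_t(y)$ for $x\in X(s)$, $y\in X(t)$, $a\in\mathcal A$; for a representation of a product system of $W^*$-correspondences one also requires $\sigma$ to be normal. Let $X(s)\otimes_\sigma H$ be the Hausdorff completion of the algebraic tensor product for $\langle x\otimes h,y\otimes g\rangle=\langle h,\sigma(\langle x,y\rangle)g\rangle$, and $\tilde T_s:X(s)\otimes_\sigma H\to H$, $\tilde T_s(x\otimes h)=T_s(x)h$. The representation is *fully coisometric* if every $\tilde T_s$ is a coisometry, and *isometric* if $T_s(x)^*T_s(y)=\sigma(\langle x,y\rangle)$ for all $s\in\mathcal S$, $x,y\in X(s)$. **Theorem.** Let $X$ be a product system over $\mathcal S$ of unital $\mathcal A$-correspondences (either of $C^*$-correspondences, or, when $\mathcal A$ is a $W^*$-algebra, of $W^*$-correspondences), and let $(\sigma,T)$ be a fully coisometric representation of $X$ on a Hilbert space $H$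 with $\sigma$ unital. Then there are a Hilbert space $K\supseteq H$ and an isometric and fully coisometric representation $(\rho,V)$ of $X$ on $K$, with $\rho$ unital, such that 0. $(\rho,V)$ is minimal: the smallest closed subspace of $K$ that contains $H$ and is invariant under all $V_s(x)$, $s\in\mathcal S$, $x\in X(s)$, is $K$; 1. $P_H$ commutes with $\rho(\mathcal A)$, and $\rho(a)P_H=\sigma(a)P_H$ for all $a\in\mathcal A$; 2. $P_HV_s(x)|_H=T_s(x)$ for all $s\in\mathcal S$, $x\in X(s)$; 3. $P_HV_s(x)|_{K\ominus H}=0$ for all $s\in\mathcal S$, $x\in X(s)$. If $\sigma$ is nondegenerate and $X$ is essential (that is, $\mathcal A X(s)$ spans a dense subspace of $X(s)$ for all $s\in\mathcal S$), then $\rho$ is nondegenerate. If $\mathcal A$ is a $W^*$-algebra, $X$ is a product system of $W^*$-correspondences and $\sigma$ is normal, then $\rho$ is normal, so that $(\rho,V)$ is again a representation of $W^*$-correspondences. -/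

import Mathlib

open scoped TensorProduct ComplexOrder RightActions CStarAlgebra

universe u v w

namespace CStarCorr

/-- A (right) Hilbert module over the unital C⋆-algebra `A` (completeness is the class
`CompleteSpace E`). Mathlib's `CStarModule` is the notion for left modules; here `A` acts on the
right, written `x <• a`, and the `A`-valued inner product `ip` is linear in the second variable. -/
class HilbertModule (A : Type*) (E : Type*) [CStarAlgebra A] [PartialOrder A]
    [NormedAddCommGroup E] [NormedSpace ℂ E] extends Module Aᵐᵒᵖ E where
  /-- the `A`-valued inner product -/
  ip : E → E → A
  ip_add_right : ∀ x y z : E, ip x (y + z) = ip x y + ip x z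
  ip_smul_right : ∀ (c : ℂ) (x y : E), ip x (c • y) = c • ip x y
  ip_rsmul : ∀ (x y : E) (a : A), ip x (y <• a) = ip x y * a
  star_ip : ∀ x y : E, star (ip x y) = ip y x
  ip_self_nonneg : ∀ x : E, 0 ≤ ip x x
  norm_sq_eq : ∀ x : E, ‖x‖ ^ 2 = ‖ip x x‖

/-- A Hilbert C⋆-correspondence over `A`: a complete right Hilbert `A`-module `E` with a left action
of `A` given by a ⋆-homomorphism into the adjointable operators on `E`. -/
class Correspondence (A : Type*) (E : Type*) [CStarAlgebra A] [PartialOrder A]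
    [NormedAddCommGroup E] [NormedSpace ℂ E] extends HilbertModule A E, CompleteSpace E where
  /-- the left action -/
  left : A →ₙₐ[ℂ] Module.End ℂ E
  ip_left : ∀ (a : A) (x y : E), ip (left a x) y = ip x (left (star a) y)

section HilbertSpaceTensor

variable {A : Type*} [CStarAlgebra A] [PartialOrder A]
variable {E : Type*} [NormedAddCommGroup E] [NormedSpace ℂ E] [HilbertModule A E]
variable {H : Type*} [NormedAddCommGroup H] [InnerProductSpace ℂ H] [CompleteSpace H]

namespace HilbertModule

lemma ip_add_left (x y z : E) : ip (A := A) (x + y) z = ip (A := A) x z + ip y z := by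
  rw [← star_ip, ip_add_right, star_add, star_ip, star_ip]

lemma ip_smul_left (c : ℂ) (x y : E) : ip (A := A) (c • x) y = star c • ip x y := by
  rw [← star_ip, ip_smul_right, star_smul, star_ip]

lemma ip_rsmul_left (a : A) (x y : E) : ip (A := A) (x <• a) y = star a * ip x y := by
  rw [← star_ip, ip_rsmul, star_mul, star_ip]

lemma ip_zero_right (x : E) : ip (A := A) x 0 = 0 := by
  simpa using ip_smul_right (A := A) 0 x 0

lemma ip_zero_left (x : E) : ip (A := A) 0 x = 0 := by
  rw [← star_ip, ip_zero_right, star_zero]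

lemma ip_sum_right {ι : Type*} (s : Finset ι) (x : E) (y : ι → E) :
    ip (A := A) x (∑ i ∈ s, y i) = ∑ i ∈ s, ip x (y i) := by
  classical
  induction s using Finset.induction_on with
  | empty => simp [ip_zero_right]
  | insert i s hi ih => rw [Finset.sum_insert hi, Finset.sum_insert hi, ip_add_right, ih]

lemma ip_sum_left {ι : Type*} (s : Finset ι) (x : ι → E) (y : E) :
    ip (A := A) (∑ i ∈ s, x i) y = ∑ i ∈ s, ip (x i) y := by
  rw [← star_ip, ip_sum_right, star_sum]
  simp only [star_ip]

end HilbertModule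


open HilbertModule

variable [StarOrderedRing A]

/-- A criterion for positivity in a C⋆-algebra. -/
lemma exists_eq_star_mul_self {B : Type*} [CStarAlgebra B] (G : B) (hsa : IsSelfAdjoint G)
    (h : ∀ P R : B, star P = P → P * G * P = -(star (R * P) * (R * P)) → R * P = 0) :
    ∃ N : B, G = star N * N := by
  let _ : PartialOrder B := CStarAlgebra.spectralOrder B
  have _ : StarOrderedRing B := CStarAlgebra.spectralOrderedRing B
  have hPnn : 0 ≤ G⁻ := CFC.negPart_nonneg G
  have hPsa : IsSelfAdjoint G⁻ := hPnn.isSelfAdjoint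
  obtain ⟨R, hR⟩ := CStarAlgebra.nonneg_iff_eq_star_mul_self.mp hPnn
  have h1 : G * G⁻ = -(G⁻ * G⁻) := by
    conv_lhs => enter [1]; rw [← CFC.posPart_sub_negPart G hsa]
    rw [sub_mul, CFC.posPart_mul_negPart, zero_sub]
  have h3 : star (R * G⁻) * (R * G⁻) = G⁻ * (G⁻ * G⁻) := by
    rw [star_mul, hPsa.star_eq, mul_assoc, ← mul_assoc (star R), ← hR]
  have hRP : R * G⁻ = 0 := h G⁻ R hPsa.star_eq (by rw [h3, mul_assoc, h1, mul_neg])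
  have hPP : star (G⁻) * G⁻ = 0 := by
    rw [hPsa.star_eq]
    calc G⁻ * G⁻ = star R * R * G⁻ := by rw [← hR]
      _ = 0 := by rw [mul_assoc, hRP, mul_zero]
  have hP0 : G⁻ = 0 := (CStarRing.star_mul_self_eq_zero_iff _).mp hPP
  have hGnn : 0 ≤ G := by
    have : G = G⁺ := by
      conv_lhs => rw [← CFC.posPart_sub_negPart G hsa, hP0, sub_zero]
    rw [this]
    exact CFC.posPart_nonneg G
  exact CStarAlgebra.nonneg_iff_eq_star_mul_self.mp hGnn

/-- Gram matrices over a Hilbert module are positive. -/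
lemma gram_eq_star_mul_self {n : Type*} [Fintype n] (x : n → E) :
    ∃ N : CStarMatrix n n A,
      CStarMatrix.ofMatrix (Matrix.of fun i j => ip (A := A) (x i) (x j)) = star N * N := by
  classical
  refine exists_eq_star_mul_self _ ?_ fun P R hPsa hGP => ?_
  · ext i j
    simp [CStarMatrix.star_apply, star_ip]
  set G : CStarMatrix n n A :=
    CStarMatrix.ofMatrix (Matrix.of fun i j => ip (A := A) (x i) (x j)) with hG
  have hdiag : ∀ j, ∑ k, star ((R * P) k j) * (R * P) k j = 0 := by
    intro j
    have hnn : (0 : A) ≤ (P * G * P) j j := by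
      have : (P * G * P) j j =
          ip (A := A) (∑ i, x i <• P i j) (∑ i, x i <• P i j) := by
        rw [ip_sum_right, CStarMatrix.mul_apply]
        refine Finset.sum_congr rfl fun k _ => ?_
        rw [ip_rsmul, ip_sum_left, CStarMatrix.mul_apply]
        congr 1
        refine Finset.sum_congr rfl fun i _ => ?_
        rw [ip_rsmul_left]
        have : star (P i j) = P j i := by
          conv_rhs => rw [← hPsa]
          rw [CStarMatrix.star_apply]
        rw [this]
        rfl
      rw [this]
      exact ip_self_nonneg _
    have hle : (0 : A) ≤ ∑ k, star ((R * P) k j) * (R * P) k j :=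
      Finset.sum_nonneg fun k _ => star_mul_self_nonneg _
    have heq : (P * G * P) j j = -∑ k, star ((R * P) k j) * (R * P) k j := by
      rw [hGP]
      rfl
    rw [heq] at hnn
    exact le_antisymm (neg_nonneg.mp hnn) hle
  ext k j
  have := (Finset.sum_eq_zero_iff_of_nonneg
    (fun k _ => star_mul_self_nonneg ((R * P) k j))).mp (hdiag j) k (Finset.mem_univ k)
  exact CStarRing.star_mul_self_eq_zero_iff _ |>.mp this

variable (σ : A →⋆ₙₐ[ℂ] (H →L[ℂ] H))

/-- The algebraic tensor product `E ⊗ H`, tagged with the representation `σ` that determines its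
semi-inner product. -/
@[nolint unusedArguments]
def AlgTensor (_σ : A →⋆ₙₐ[ℂ] (H →L[ℂ] H)) (E : Type*) [NormedAddCommGroup E] [NormedSpace ℂ E] :=
  E ⊗[ℂ] H

namespace AlgTensor

instance : AddCommGroup (AlgTensor σ E) := inferInstanceAs (AddCommGroup (E ⊗[ℂ] H))
instance : Module ℂ (AlgTensor σ E) := inferInstanceAs (Module ℂ (E ⊗[ℂ] H))

/-- The sesquilinear form `⟨x ⊗ h, y ⊗ g⟩ = ⟨h, σ(⟨x, y⟩) g⟩`. -/
noncomputable def form : E ⊗[ℂ] H →ₗ⋆[ℂ] E ⊗[ℂ] H →ₗ[ℂ] ℂ :=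
  TensorProduct.lift <| LinearMap.mk₂'ₛₗ (starRingEnd ℂ) (starRingEnd ℂ)
    (fun (x : E) (h : H) => TensorProduct.lift <| LinearMap.mk₂ ℂ
      (fun (y : E) (g : H) => inner ℂ h (σ (ip x y) g))
      (by intros; simp [ip_add_right])
      (by intros; simp [ip_smul_right])
      (by intros; simp)
      (by intros; simp))
    (by intros; ext; simp [ip_add_left])
    (by intros; ext; simp [ip_smul_left])
    (by intros; ext; simp)
    (by intros; ext; simp [mul_comm])

lemma form_tmul (x y : E) (h g : H) :
    form σ (x ⊗ₜ h) (y ⊗ₜ g) = inner ℂ h (σ (ip x y) g) := rfl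

lemma form_symm (z z' : E ⊗[ℂ] H) : starRingEnd ℂ (form σ z' z) = form σ z z' := by
  induction z using TensorProduct.induction_on with
  | zero => simp
  | add a b ha hb => simp [ha, hb]
  | tmul x h =>
    induction z' using TensorProduct.induction_on with
    | zero => simp
    | add a b ha hb => simp [ha, hb]
    | tmul y g =>
      rw [form_tmul, form_tmul, inner_conj_symm, ← star_ip y x, map_star,
        ContinuousLinearMap.star_eq_adjoint, ContinuousLinearMap.adjoint_inner_right]

lemma form_self_nonneg (z : E ⊗[ℂ] H) : 0 ≤ (form σ z z).re := by
  obtain ⟨s, rfl⟩ := TensorProduct.exists_finset z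
  obtain ⟨N, hN⟩ := gram_eq_star_mul_self (A := A) (fun i : s => (i : E × H).1)
  have hip : ∀ i j : s, ip (A := A) (i : E × H).1 (j : E × H).1 =
      ∑ k, star (N k i) * N k j := fun i j => congrFun (congrFun hN i) j
  have key : form σ (∑ i ∈ s, i.1 ⊗ₜ i.2) (∑ i ∈ s, i.1 ⊗ₜ i.2) =
      ∑ k : s, inner ℂ (∑ i : s, σ (N k i) (i : E × H).2) (∑ i : s, σ (N k i) (i : E × H).2) := by
    rw [← Finset.sum_coe_sort s]
    simp only [map_sum, LinearMap.sum_apply, form_tmul, hip, sum_inner, inner_sum, map_mul,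
      map_star, ContinuousLinearMap.star_eq_adjoint, mul_apply_eq_comp,
      sum_apply, ContinuousLinearMap.adjoint_inner_right]
    conv_rhs => rw [Finset.sum_comm]
    exact Finset.sum_congr rfl fun j _ => Finset.sum_comm
  rw [key, Complex.re_sum]
  exact Finset.sum_nonneg fun k _ => inner_self_nonneg (𝕜 := ℂ)

/-- The semi-inner product on the algebraic tensor product. -/
noncomputable abbrev core : PreInnerProductSpace.Core ℂ (AlgTensor σ E) where
  inner z z' := form σ z z'
  conj_inner_symm z z' := form_symm σ z z'
  re_inner_nonneg z := form_self_nonneg σ z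
  add_left z z' z'' := LinearMap.map_add₂ (form σ) z z' z''
  smul_left z z' c := LinearMap.map_smulₛₗ₂ (form σ) c z z'

noncomputable instance : SeminormedAddCommGroup (AlgTensor σ E) :=
  InnerProductSpace.Core.toSeminormedAddCommGroup (c := core σ)
noncomputable instance : InnerProductSpace ℂ (AlgTensor σ E) :=
  InnerProductSpace.ofCore (core σ)

end AlgTensor

/-- The Hilbert space `E ⊗_σ H`: the Hausdorff completion of the algebraic tensor product with
respect to the semi-inner product `⟨x ⊗ h, y ⊗ g⟩ = ⟨h, σ(⟨x, y⟩) g⟩`. -/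
abbrev HilbertTensor (σ : A →⋆ₙₐ[ℂ] (H →L[ℂ] H)) (E : Type*) [NormedAddCommGroup E]
    [NormedSpace ℂ E] [HilbertModule A E] :=
  UniformSpace.Completion (AlgTensor σ E)

/-- The elementary tensor `x ⊗ h` in `E ⊗_σ H`. -/
noncomputable def HilbertTensor.tmul (x : E) (h : H) : HilbertTensor σ E :=
  ((show AlgTensor σ E from x ⊗ₜ[ℂ] h) : UniformSpace.Completion (AlgTensor σ E))

lemma HilbertTensor.inner_tmul (x y : E) (h g : H) :
    inner ℂ (HilbertTensor.tmul σ x h) (HilbertTensor.tmul σ y g) = inner ℂ h (σ (ip x y) g) :=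
  UniformSpace.Completion.inner_coe _ _

end HilbertSpaceTensor

section Representations

variable {A : Type*} [CStarAlgebra A] [PartialOrder A] [StarOrderedRing A]
variable {E : Type*} [NormedAddCommGroup E] [NormedSpace ℂ E]
variable {H : Type*} [NormedAddCommGroup H] [InnerProductSpace ℂ H] [CompleteSpace H]

open HilbertModule Correspondence

/-- `σ(A)H` spans a dense subspace of `H`. -/
def IsNondegenerate (σ : A →⋆ₙₐ[ℂ] (H →L[ℂ] H)) : Prop :=
  (Submodule.span ℂ {v : H | ∃ a h, v = σ a h}).topologicalClosure = ⊤

/-- `σ` is normal: if a directed set `D` of self-adjoint elements has supremum `a`, then `σ(d)`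
increases weakly to `σ(a)` along `D`. -/
def IsNormal (σ : A →⋆ₙₐ[ℂ] (H →L[ℂ] H)) : Prop :=
  ∀ (D : Set A) (a : A), D.Nonempty → DirectedOn (· ≤ ·) D → (∀ d ∈ D, IsSelfAdjoint d) →
    IsLUB D a → ∀ h : H,
      IsLUB ((fun d => (inner ℂ h (σ d h)).re) '' D) (inner ℂ h (σ a h)).re

/-- `(σ, T)` is a completely contractive covariant representation of the correspondence `E` on `H`.
The matrix norm of `(x i j) ∈ Mₙ(E)` is that of the Hilbert `Mₙ(A)`-module `Mₙ(E)`, whose inner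
product is `⟨x, y⟩ i j = ∑ k, ⟨x k i, y k j⟩`. -/
structure IsCCRep [Correspondence A E] (σ : A →⋆ₙₐ[ℂ] (H →L[ℂ] H)) (T : E →ₗ[ℂ] (H →L[ℂ] H)) :
    Prop where
  completelyContractive : ∀ (n : ℕ) (x : Fin n → Fin n → E),
    ‖CStarMatrix.ofMatrix (Matrix.of fun i j => T (x i j))‖ ^ 2 ≤
      ‖CStarMatrix.ofMatrix (Matrix.of fun i j => ∑ k, ip (A := A) (x k i) (x k j))‖
  nondegenerate : IsNondegenerate σ
  map_rsmul : ∀ (x : E) (a : A), T (x <• a) = T x ∘L σ a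
  map_left : ∀ (a : A) (x : E), T (left a x) = σ a ∘L T x

/-- `T(x)^* T(y) = σ(⟨x, y⟩)` for all `x`, `y`. -/
def IsIsometricRep [HilbertModule A E] (σ : A →⋆ₙₐ[ℂ] (H →L[ℂ] H)) (T : E →ₗ[ℂ] (H →L[ℂ] H)) :
    Prop :=
  ∀ x y : E, ContinuousLinearMap.adjoint (T x) ∘L T y = σ (ip x y)

/-- The operator `T̃ : E ⊗_σ H → H`, `x ⊗ h ↦ T(x) h`, is a coisometry. -/
def IsFullyCoisometricRep [HilbertModule A E] (σ : A →⋆ₙₐ[ℂ] (H →L[ℂ] H))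
    (T : E →ₗ[ℂ] (H →L[ℂ] H)) : Prop :=
  ∃ Tt : HilbertTensor σ E →L[ℂ] H, (∀ x h, Tt (HilbertTensor.tmul σ x h) = T x h) ∧
    Tt ∘L ContinuousLinearMap.adjoint Tt = ContinuousLinearMap.id ℂ H

end Representations

section TensorProducts

open HilbertModule Correspondence

variable (A : Type*) [CStarAlgebra A] [PartialOrder A]

/-- For a W⋆-algebra `A`: the correspondence `E` is a W⋆-correspondence, that is, `E` is self-dual
(every bounded right `A`-linear map `E → A` is `x ↦ ⟨y, x⟩` for some `y`) and the left action is
normal (if a directed set `D` of self-adjoint elements has supremum `a`, then for every `x`,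
`⟨x, a x⟩` is the supremum of the `⟨x, d x⟩`, `d ∈ D`). -/
structure IsWStarCorrespondence (E : Type*) [NormedAddCommGroup E] [NormedSpace ℂ E]
    [Correspondence A E] : Prop where
  selfDual : ∀ τ : E →L[ℂ] A, (∀ (x : E) (a : A), τ (x <• a) = τ x * a) →
    ∃ y : E, ∀ x, τ x = ip y x
  normal : ∀ (D : Set A) (a : A), D.Nonempty → DirectedOn (· ≤ ·) D →
    (∀ d ∈ D, IsSelfAdjoint d) → IsLUB D a → ∀ x : E,
      IsLUB ((fun d => ip (A := A) x (left d x)) '' D) (ip x (left a x))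

variable {E : Type*} [NormedAddCommGroup E] [NormedSpace ℂ E] [Correspondence A E]
variable {F : Type*} [NormedAddCommGroup F] [NormedSpace ℂ F] [Correspondence A F]
variable {G : Type*} [NormedAddCommGroup G] [NormedSpace ℂ G] [Correspondence A G]

/-- The linear span in `G` of the products `m x y`. -/
def productSpan (m : E →ₗ[ℂ] F →ₗ[ℂ] G) : Submodule ℂ G :=
  Submodule.span ℂ {z : G | ∃ x y, z = m x y}

/-- The bilinear map `m : E × F → G` induces a map of bimodules on the algebraic tensor product that
preserves the `A`-valued inner product `⟨x ⊗ y, x' ⊗ y'⟩ = ⟨y, ⟨x, x'⟩ y'⟩`. -/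
structure PreservesTensor (m : E →ₗ[ℂ] F →ₗ[ℂ] G) : Prop where
  ip_mul : ∀ (x x' : E) (y y' : F),
    ip (A := A) (m x y) (m x' y') = ip y (left (ip (A := A) x x') y')
  left_mul : ∀ (a : A) (x : E) (y : F), left a (m x y) = m (left a x) y
  mul_rsmul : ∀ (x : E) (y : F) (a : A), m x (y <• a) = m x y <• a

/-- `m` extends to an isomorphism of correspondences from the balanced tensor product `E ⊗_A F`
(the Hausdorff completion of the algebraic tensor product) onto the complete module `G`. -/
structure IsTensorProduct (m : E →ₗ[ℂ] F →ₗ[ℂ] G) : Prop extends PreservesTensor A m where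
  dense : (productSpan m).topologicalClosure = ⊤

/-- `m` extends to an isomorphism of W⋆-correspondences from the self-dual extension of `E ⊗_A F`
onto `G`. The self-dual extension of a pre-Hilbert module `F₀` over a W⋆-algebra is the module of
all bounded right `A`-linear maps `F₀ → A`, with `F₀` embedded by the inner product; so the
condition is that every such map on the span of the products is given by exactly one element of
`G`. -/
structure IsSelfDualTensorProduct (m : E →ₗ[ℂ] F →ₗ[ℂ] G) : Prop extends
    PreservesTensor A m where
  existsUnique : ∀ τ : productSpan m →L[ℂ] A,
    (∀ (z z' : productSpan m) (a : A), (z' : G) = (z : G) <• a → τ z' = τ z * a) →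
      ∃! g : G, ∀ z : productSpan m, τ z = ip g (z : G)

end TensorProducts

section ProductSystems

open HilbertModule Correspondence

/-- The multiplicative structure of a product system over a commutative monoid `S`: a family of
correspondences `X s` whose total space `Σ s, X s` is a semigroup over `S`, and an identification
`unit` of `A` with `X 0` under which multiplication by `X 0` is the left and right action. -/
structure Multiplication (A : Type u) [CStarAlgebra A] [PartialOrder A] {S : Type*}
    [AddCommMonoid S] (X : S → Type v) [∀ s, NormedAddCommGroup (X s)]
    [∀ s, NormedSpace ℂ (X s)] [∀ s, Correspondence A (X s)] where
  /-- the product `X s × X t → X (s + t)` -/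
  mul : ∀ s t : S, X s →ₗ[ℂ] X t →ₗ[ℂ] X (s + t)
  mul_assoc : ∀ (s t r : S) (x : X s) (y : X t) (z : X r),
    (⟨s + t + r, mul (s + t) r (mul s t x y) z⟩ : Σ s, X s) =
      ⟨s + (t + r), mul s (t + r) x (mul t r y z)⟩
  /-- the identification of the correspondence `A` with `X 0` -/
  unit : A ≃ₗ[ℂ] X 0
  ip_unit : ∀ a b : A, ip (unit a) (unit b) = star a * b
  left_unit : ∀ a b : A, left a (unit b) = unit (a * b)
  unit_rsmul : ∀ a b : A, unit a <• b = unit (a * b)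
  unit_mul : ∀ (s : S) (a : A) (x : X s),
    (⟨0 + s, mul 0 s (unit a) x⟩ : Σ s, X s) = ⟨s, left a x⟩
  mul_unit : ∀ (s : S) (x : X s) (a : A),
    (⟨s + 0, mul s 0 x (unit a)⟩ : Σ s, X s) = ⟨s, x <• a⟩

variable {A : Type u} [CStarAlgebra A] [PartialOrder A] {S : Type*}
    [AddCommMonoid S] {X : S → Type v} [∀ s, NormedAddCommGroup (X s)]
    [∀ s, NormedSpace ℂ (X s)] [∀ s, Correspondence A (X s)]

/-- `X` is a (discrete) product system of C⋆-correspondences. -/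
def Multiplication.IsProductSystem (P : Multiplication A X) : Prop :=
  ∀ s t : S, s ≠ 0 → t ≠ 0 → IsTensorProduct A (P.mul s t)

/-- `A` is a W⋆-algebra and `X` is a (discrete) product system of W⋆-correspondences. -/
structure Multiplication.IsWStarProductSystem (P : Multiplication A X) : Prop where
  wStarAlgebra : WStarAlgebra A
  wStarCorrespondence : ∀ s : S, IsWStarCorrespondence A (X s)
  tensor : ∀ s t : S, s ≠ 0 → t ≠ 0 → IsSelfDualTensorProduct A (P.mul s t)

variable [StarOrderedRing A]

/-- A completely contractive covariant representation `(σ, T)` of `X` on the Hilbert space `H`. -/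
structure Representation (P : Multiplication A X) (H : Type*) [NormedAddCommGroup H]
    [InnerProductSpace ℂ H] [CompleteSpace H] where
  /-- the representation of `A` -/
  σ : A →⋆ₙₐ[ℂ] (H →L[ℂ] H)
  /-- the maps on the fibres -/
  T : ∀ s : S, X s →ₗ[ℂ] (H →L[ℂ] H)
  T_unit : ∀ a : A, T 0 (P.unit a) = σ a
  isCCRep : ∀ s : S, IsCCRep σ (T s)
  map_mul : ∀ (s t : S) (x : X s) (y : X t), T (s + t) (P.mul s t x y) = T s x ∘L T t y

namespace Representation

variable {P : Multiplication A X}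
variable {H : Type*} [NormedAddCommGroup H] [InnerProductSpace ℂ H] [CompleteSpace H]
variable {K : Type*} [NormedAddCommGroup K] [InnerProductSpace ℂ K] [CompleteSpace K]

/-- Every fibre representation is isometric. -/
def IsIsometric (R : Representation P H) : Prop := ∀ s, IsIsometricRep R.σ (R.T s)

/-- Every fibre representation is fully coisometric. -/
def IsFullyCoisometric (R : Representation P H) : Prop := ∀ s, IsFullyCoisometricRep R.σ (R.T s)

/-- The smallest closed subspace of `K` that contains `u(H)` and is invariant under all operators
`V_s(x)` is `K`. -/
def IsMinimal (V : Representation P K) (u : H →ₗᵢ[ℂ] K) : Prop :=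
  ∀ M : Submodule ℂ K, IsClosed (M : Set K) → (∀ h, u h ∈ M) →
    (∀ (s : S) (x : X s), ∀ k ∈ M, V.T s x k ∈ M) → M = ⊤

end Representation

/-- The orthogonal projection `P_H = u u^*` of `K` onto the image of the isometry `u : H → K`. -/
noncomputable def imageProjection {H K : Type*} [NormedAddCommGroup H] [InnerProductSpace ℂ H]
    [CompleteSpace H] [NormedAddCommGroup K] [InnerProductSpace ℂ K] [CompleteSpace K]
    (u : H →ₗᵢ[ℂ] K) : K →L[ℂ] K :=
  u.toContinuousLinearMap ∘L ContinuousLinearMap.adjoint u.toContinuousLinearMap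

end ProductSystems

end CStarCorr

/-!
The dilation space is a direct limit. Since `T̃_r : X r ⊗_σ H → H` is a coisometry, `T̃_r⋆` is an
isometry, and so is `1 ⊗ T̃_r⋆ : X s ⊗_σ H → X s ⊗ X r ⊗_σ H ⊆ X (s + r) ⊗_σ H`. The condition on
positive parts makes the pointwise order of the semigroup agree with divisibility, so these maps form
a directed system of Hilbert spaces indexed by the semigroup
(`CStarCorr.Representation.directedSystem_transition`), and `K` is its limit
(`CStarCorr.exists_hilbert_directLimit`).

Multiplication from the left by `x ∈ X r`, that is `y ⊗ k ↦ xy ⊗ k`, commutes with the connecting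
maps, which only touch the right end of a tensor. It therefore defines operators `V_r(x)` on `K`
(`CStarCorr.Representation.shift`). They form an isometric representation because multiplication
preserves the `A`-valued inner products, and `H`, embedded through `T̃_s⋆` for any `s`, is coinvariant:
`P_H V_r(x) = T_r(x) P_H` on `X s ⊗_σ H` is the multiplicativity `T̃_{r+s} = T̃_r (1 ⊗ T̃_s)`
(`CStarCorr.Representation.adjoint_limitEmbedding_shift`). This identity contains the dilation
property, the vanishing on `K ⊖ H`, and, for `r = 0`, the statements about `ρ`. Minimality holds
since `V_s(x) k = x ⊗ k`.

Full coisometry requires that the vectors `xy ⊗ k` span a dense subspace of `X (s + t) ⊗_σ H`. For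
C⋆-correspondences this is part of the definition of a product system. For W⋆-correspondences one
only knows that no nonzero vector of the self-dual module `E = X (s + t)` annihilates the span `F` of
the products, and the normality of `σ` has to be used. For finite subsets of `F` consider the
resolvents `R = (1 + ∑ y ⟨y, ·⟩)⁻¹` on `E`. They decrease as the subset grows, and `x - R x` lies in
`F`. A weak-⋆ limit of the forms `⟨x, R y⟩`, which exists because `A` has a predual, is an
`A`-valued sesquilinear form. It is `A`-linear, because conjugation by invertible elements preserves
infima, and it vanishes for `y ∈ F`. By self-duality it is given by vectors that annihilate `F`, so
it is zero. Hence `⟨x, R x⟩` decreases to `0` (`CStarCorr.isGLB_ip_resolvent`), and since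
`⟨R x, R x⟩ ≤ ⟨x, R x⟩`, normality of `σ` gives `R x ⊗ k → 0`, so that `x ⊗ k` is a limit of the
tensors `(x - R x) ⊗ k` (`CStarCorr.topologicalClosure_span_tmul_of_selfDual`).

Normality of `ρ` may be tested on the total set of vectors `x ⊗ k`
(`CStarCorr.isNormal_of_dense_span`), where it follows from that of `σ` and of the left actions.
-/

namespace CStarCorr

/-! ### The Hilbert space `E ⊗_σ H` -/

section HilbertTensor

open HilbertModule Correspondence

variable {A : Type*} [CStarAlgebra A] [PartialOrder A] [StarOrderedRing A]
variable {H : Type*} [NormedAddCommGroup H] [InnerProductSpace ℂ H] [CompleteSpace H]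
variable {L : Type*} [NormedAddCommGroup L] [InnerProductSpace ℂ L] [CompleteSpace L]
variable (σ : A →⋆ₙₐ[ℂ] (H →L[ℂ] H))

namespace HilbertTensor

section Module

variable {E : Type*} [NormedAddCommGroup E] [NormedSpace ℂ E] [HilbertModule A E]
variable {F : Type*} [NormedAddCommGroup F] [NormedSpace ℂ F] [HilbertModule A F]

/-- The canonical map from the algebraic tensor product to its Hausdorff completion. -/
noncomputable def of : E ⊗[ℂ] H →ₗ[ℂ] HilbertTensor σ E :=
  (UniformSpace.Completion.toComplₗᵢ (𝕜 := ℂ) (E := AlgTensor σ E)).toLinearMap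

lemma of_tmul (x : E) (h : H) : of σ (x ⊗ₜ h) = tmul σ x h := rfl

lemma inner_of (z z' : E ⊗[ℂ] H) :
    inner ℂ (of σ z) (of σ z') = AlgTensor.form σ z z' :=
  UniformSpace.Completion.inner_coe (E := AlgTensor σ E) z z'

lemma denseRange_of : DenseRange (of (E := E) σ) :=
  UniformSpace.Completion.denseRange_coe (α := AlgTensor σ E)

lemma norm_of_sq (z : E ⊗[ℂ] H) : ‖of σ z‖ ^ 2 = (AlgTensor.form σ z z).re := by
  rw [← inner_of, ← inner_self_eq_norm_sq (𝕜 := ℂ)]; rfl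

/-- The bilinear map `(x, h) ↦ x ⊗ h`. -/
noncomputable def mk : E →ₗ[ℂ] H →ₗ[ℂ] HilbertTensor σ E :=
  (TensorProduct.mk ℂ E H).compr₂ (of σ)

@[simp] lemma mk_apply (x : E) (h : H) : mk σ x h = tmul σ x h := rfl

lemma norm_tmul_le (x : E) (h : H) : ‖tmul σ x h‖ ≤ ‖x‖ * ‖h‖ := by
  refine le_of_sq_le_sq ?_ (by positivity)
  have h1 : ‖tmul σ x h‖ ^ 2 = (inner ℂ h (σ (ip x x) h) : ℂ).re := by
    rw [← inner_tmul, ← inner_self_eq_norm_sq (𝕜 := ℂ)]; rfl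
  rw [h1, mul_pow, norm_sq_eq (A := A)]
  calc _ ≤ ‖(inner ℂ h (σ (ip x x) h) : ℂ)‖ := Complex.re_le_norm _
    _ ≤ ‖h‖ * ‖σ (ip x x) h‖ := norm_inner_le_norm _ _
    _ ≤ ‖h‖ * (‖(ip x x : A)‖ * ‖h‖) := by
      gcongr
      exact ((σ (ip x x)).le_opNorm h).trans
        (by gcongr; exact NonUnitalStarAlgHom.norm_apply_le σ _)
    _ = _ := by ring

lemma topologicalClosure_span_tmul :
    (Submodule.span ℂ {ζ : HilbertTensor σ E | ∃ x h, ζ = tmul σ x h}).topologicalClosure = ⊤ := by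
  rw [← Submodule.dense_iff_topologicalClosure_eq_top]
  refine (denseRange_of (E := E) σ).mono ?_
  rintro _ ⟨z, rfl⟩
  induction z using TensorProduct.induction_on with
  | zero => simp
  | tmul x h => exact Submodule.subset_span ⟨x, h, rfl⟩
  | add a b ha hb => rw [map_add]; exact add_mem ha hb

variable {σ}

lemma eq_top_of_tmul_mem {M : Submodule ℂ (HilbertTensor σ E)}
    (hM : IsClosed (M : Set (HilbertTensor σ E))) (h : ∀ x k, tmul σ x k ∈ M) : M = ⊤ := by
  rw [eq_top_iff, ← topologicalClosure_span_tmul]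
  refine Submodule.topologicalClosure_minimal _ (Submodule.span_le.mpr ?_) hM
  rintro _ ⟨x, k, rfl⟩
  exact h x k

/-- Elementary tensors separate bounded operators. -/
lemma clm_ext {F : Type*} [NormedAddCommGroup F] [NormedSpace ℂ F]
    {f g : HilbertTensor σ E →L[ℂ] F} (h : ∀ x k, f (tmul σ x k) = g (tmul σ x k)) : f = g := by
  refine ContinuousLinearMap.ext fun ζ => ?_
  refine congrFun ((denseRange_of (E := E) σ).equalizer f.continuous g.continuous ?_) ζ
  funext z
  induction z using TensorProduct.induction_on with
  | zero => simp
  | tmul x k => exact h x k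
  | add a b ha hb => simpa using congrArg₂ (· + ·) ha hb

/-- Two vectors having the same inner product with every elementary tensor agree. -/
lemma ext_inner {ξ η : HilbertTensor σ E}
    (h : ∀ x k, inner ℂ (tmul σ x k) ξ = inner ℂ (tmul σ x k) η) : ξ = η := by
  have := clm_ext (f := innerSL ℂ ξ) (g := innerSL ℂ η) fun x k => by
    rw [innerSL_apply_apply, innerSL_apply_apply, ← inner_conj_symm, h, inner_conj_symm]
  refine ext_inner_right ℂ fun v => ?_
  simpa using congrArg (fun f => f v) this

/-- The bounded operator on `E ⊗_σ H` extending a bilinear map (a junk value unless the bilinear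
map is bounded for the norm of `E ⊗_σ H`). -/
noncomputable def lift (B : E →ₗ[ℂ] H →ₗ[ℂ] L) : HilbertTensor σ E →L[ℂ] L :=
  (TensorProduct.lift B).extendOfNorm (of σ)

lemma lift_of {B : E →ₗ[ℂ] H →ₗ[ℂ] L} {C : ℝ}
    (hB : ∀ z, ‖TensorProduct.lift B z‖ ≤ C * ‖of σ z‖) (z : E ⊗[ℂ] H) :
    lift B (of σ z) = TensorProduct.lift B z :=
  LinearMap.extendOfNorm_eq (denseRange_of σ) ⟨C, hB⟩ z

lemma lift_tmul {B : E →ₗ[ℂ] H →ₗ[ℂ] L} {C : ℝ}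
    (hB : ∀ z, ‖TensorProduct.lift B z‖ ≤ C * ‖of σ z‖) (x : E) (h : H) :
    lift (σ := σ) B (tmul σ x h) = B x h :=
  lift_of hB (x ⊗ₜ h)

variable (σ) in
/-- The bounded operator `T ⊗ 1` from `E ⊗_σ H` to `F ⊗_σ H` (a junk value unless `T ⊗ 1` is
bounded on the algebraic tensor product). -/
noncomputable def amplify (T : E →ₗ[ℂ] F) : HilbertTensor σ E →L[ℂ] HilbertTensor σ F :=
  lift ((mk σ).comp T)

omit [HilbertModule A E] in
lemma lift_mk_comp (T : E →ₗ[ℂ] F) (z : E ⊗[ℂ] H) :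
    TensorProduct.lift ((mk σ).comp T) z = of σ (T.rTensor H z) := by
  induction z using TensorProduct.induction_on with
  | zero => simp
  | add a b ha hb => rw [map_add, ha, hb, map_add, map_add]
  | tmul x h => rfl

lemma amplify_of {T : E →ₗ[ℂ] F} {C : ℝ} (hT : ∀ z, ‖of σ (T.rTensor H z)‖ ≤ C * ‖of σ z‖)
    (z : E ⊗[ℂ] H) : amplify σ T (of σ z) = of σ (T.rTensor H z) := by
  rw [amplify, lift_of (C := C) (by simpa only [lift_mk_comp] using hT), lift_mk_comp]

lemma amplify_tmul {T : E →ₗ[ℂ] F} {C : ℝ} (hT : ∀ z, ‖of σ (T.rTensor H z)‖ ≤ C * ‖of σ z‖)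
    (x : E) (h : H) : amplify σ T (tmul σ x h) = tmul σ (T x) h :=
  amplify_of hT (x ⊗ₜ h)

/-- A bilinear map that reproduces the inner product of elementary tensors extends to an
isometry. -/
lemma exists_isometry {B : E →ₗ[ℂ] H →ₗ[ℂ] L}
    (hB : ∀ x x' h h', inner ℂ (B x h) (B x' h') = inner ℂ h (σ (ip x x') h')) :
    ∃ U : HilbertTensor σ E →ₗᵢ[ℂ] L, ∀ x h, U (tmul σ x h) = B x h := by
  have key : ∀ z z', inner ℂ (TensorProduct.lift B z) (TensorProduct.lift B z') =
      AlgTensor.form σ z z' := by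
    intro z z'
    induction z using TensorProduct.induction_on with
    | zero => simp
    | add a b ha hb => simp only [map_add, inner_add_left, ha, hb, LinearMap.add_apply]
    | tmul x h =>
      induction z' using TensorProduct.induction_on with
      | zero => simp
      | add a b ha hb => rw [map_add, inner_add_right, ha, hb, map_add]
      | tmul y g => exact hB x y h g
  have hn : ∀ z, ‖TensorProduct.lift B z‖ = ‖of σ z‖ := by
    intro z
    rw [← sq_eq_sq₀ (norm_nonneg _) (norm_nonneg _), norm_of_sq, ← key,
      ← inner_self_eq_norm_sq (𝕜 := ℂ)]
    rfl
  have hC : ∀ z, ‖TensorProduct.lift B z‖ ≤ 1 * ‖of σ z‖ := fun z => by rw [hn, one_mul]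
  refine ⟨⟨(lift (σ := σ) B).toLinearMap, fun ζ => ?_⟩, fun x h => lift_tmul hC x h⟩
  refine (denseRange_of σ).induction (P := fun ζ => ‖lift (σ := σ) B ζ‖ = ‖ζ‖) ?_
    (isClosed_eq (by fun_prop) (by fun_prop)) ζ
  rintro _ ⟨z, rfl⟩
  rw [lift_of hC, hn]

end Module

section LeftAction

variable {E : Type*} [NormedAddCommGroup E] [NormedSpace ℂ E] [Correspondence A E]
variable {F : Type*} [NormedAddCommGroup F] [NormedSpace ℂ F] [Correspondence A F]
variable {G : Type*} [NormedAddCommGroup G] [NormedSpace ℂ G] [Correspondence A G]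

lemma form_left (a : A) (z z' : E ⊗[ℂ] H) :
    AlgTensor.form σ ((left a).rTensor H z) z' =
      AlgTensor.form σ z ((left (star a) : Module.End ℂ E).rTensor H z') := by
  induction z using TensorProduct.induction_on with
  | zero => simp
  | add a b ha hb => simp [ha, hb]
  | tmul x h =>
    induction z' using TensorProduct.induction_on with
    | zero => simp
    | add a b ha hb => simp only [map_add, ha, hb]
    | tmul y g =>
      rw [LinearMap.rTensor_tmul, LinearMap.rTensor_tmul, AlgTensor.form_tmul,
        AlgTensor.form_tmul, ip_left]

lemma norm_of_left_le (h1 : ∀ x : E, left (1 : A) x = x) (a : A) (z : E ⊗[ℂ] H) :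
    ‖of σ ((left a).rTensor H z)‖ ≤ ‖a‖ * ‖of σ z‖ := by
  refine le_of_sq_le_sq ?_ (by positivity)
  -- positivity of `‖a‖² - a⋆a = b⋆b` gives the bound
  obtain ⟨b, hb⟩ := CStarAlgebra.nonneg_iff_eq_star_mul_self.mp
    (sub_nonneg.mpr (CStarAlgebra.star_mul_le_algebraMap_norm_sq (a := a)))
  have hE : ∀ c : A, AlgTensor.form σ ((left c).rTensor H z) ((left c).rTensor H z) =
      AlgTensor.form σ z ((left (star c * c) : Module.End ℂ E).rTensor H z) := by
    intro c
    rw [form_left, map_mul, Module.End.mul_eq_comp, LinearMap.rTensor_comp, LinearMap.comp_apply]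
  have hid : (left (1 : A) : Module.End ℂ E) = LinearMap.id := LinearMap.ext h1
  have h2 : (algebraMap ℝ A (‖a‖ ^ 2)) = ((‖a‖ ^ 2 : ℝ) : ℂ) • (1 : A) := by
    rw [Algebra.algebraMap_eq_smul_one, Complex.coe_smul]
  have h3 := hE b
  rw [← hb, map_sub, LinearMap.rTensor_sub, LinearMap.sub_apply, map_sub, h2, map_smul, hid,
    LinearMap.rTensor_smul, LinearMap.rTensor_id, LinearMap.smul_apply, LinearMap.id_apply,
    map_smul, ← hE a] at h3
  have h4 := AlgTensor.form_self_nonneg σ ((left b).rTensor H z)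
  rw [h3, smul_eq_mul, Complex.sub_re, Complex.re_ofReal_mul] at h4
  rw [mul_pow, norm_of_sq, norm_of_sq]
  linarith

variable (E) in
/-- The operators `a ⊗ 1` on `E ⊗_σ H`, for a unital correspondence `E`. -/
noncomputable def leftAction (h1 : ∀ x : E, left (1 : A) x = x) :
    A →⋆ₙₐ[ℂ] (HilbertTensor σ E →L[ℂ] HilbertTensor σ E) :=
  have hT (a : A) (x : E) (h : H) :
      amplify σ (left a : Module.End ℂ E) (tmul σ x h) = tmul σ (left a x) h :=
    amplify_tmul (norm_of_left_le σ h1 a) x h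
  { toFun a := amplify σ (left a)
    map_smul' c a := clm_ext fun x k => by
      rw [MonoidHom.id_apply, smul_apply, hT, hT, map_smul, LinearMap.smul_apply, ← mk_apply,
        map_smul, LinearMap.smul_apply, mk_apply]
    map_zero' := clm_ext fun x k => by
      rw [hT, map_zero, LinearMap.zero_apply, ← mk_apply, map_zero]; rfl
    map_add' a b := clm_ext fun x k => by
      rw [add_apply, hT, hT, hT, map_add, LinearMap.add_apply, ← mk_apply,
        map_add, LinearMap.add_apply, mk_apply, mk_apply]
    map_mul' a b := clm_ext fun x k => by
      rw [mul_apply_eq_comp, hT, hT, hT, map_mul, Module.End.mul_apply]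
    map_star' a := clm_ext fun x k => ext_inner fun y l => by
      rw [ContinuousLinearMap.star_eq_adjoint, ContinuousLinearMap.adjoint_inner_right, hT, hT,
        inner_tmul, inner_tmul, ip_left] }

lemma leftAction_tmul (h1 : ∀ x : E, left (1 : A) x = x) (a : A) (x : E) (h : H) :
    leftAction σ E h1 a (tmul σ x h) = tmul σ (left a x) h :=
  amplify_tmul (norm_of_left_le σ h1 a) x h

variable {σ}

section Multiplication

variable {m : E →ₗ[ℂ] F →ₗ[ℂ] G} (hm : PreservesTensor A m) (h1 : ∀ y : F, left (1 : A) y = y)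
include hm

lemma inner_of_mul (x x' : E) (z z' : F ⊗[ℂ] H) :
    inner ℂ (of σ ((m x).rTensor H z)) (of σ ((m x').rTensor H z')) =
      inner ℂ (of σ z) (leftAction σ F h1 (ip x x') (of σ z')) := by
  induction z using TensorProduct.induction_on with
  | zero => simp
  | add a b ha hb => simp only [map_add, inner_add_left, ha, hb]
  | tmul y h =>
    induction z' using TensorProduct.induction_on with
    | zero => simp
    | add a b ha hb => simp only [map_add, inner_add_right, ha, hb]
    | tmul y' g =>
      simp only [LinearMap.rTensor_tmul, of_tmul, leftAction_tmul, inner_tmul, hm.ip_mul]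

include h1 in
lemma norm_of_mul_le (x : E) (z : F ⊗[ℂ] H) :
    ‖of σ ((m x).rTensor H z)‖ ≤ ‖x‖ * ‖of σ z‖ := by
  refine le_of_sq_le_sq ?_ (by positivity)
  rw [← inner_self_eq_norm_sq (𝕜 := ℂ), inner_of_mul hm h1, mul_pow, norm_sq_eq (A := A)]
  calc _ ≤ ‖(inner ℂ (of σ z) (leftAction σ F h1 (ip x x) (of σ z)) : ℂ)‖ := Complex.re_le_norm _
    _ ≤ ‖of σ z‖ * ‖leftAction σ F h1 (ip x x) (of σ z)‖ := norm_inner_le_norm _ _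
    _ ≤ ‖of σ z‖ * (‖(ip x x : A)‖ * ‖of σ z‖) := by
      gcongr
      exact (ContinuousLinearMap.le_opNorm _ _).trans
        (by gcongr; exact NonUnitalStarAlgHom.norm_apply_le _ _)
    _ = _ := by ring

include h1 in
lemma amplify_mul_tmul (x : E) (y : F) (h : H) :
    amplify σ (m x) (tmul σ y h) = tmul σ (m x y) h :=
  amplify_tmul (norm_of_mul_le hm h1 x) y h

lemma inner_amplify_mul (x x' : E) (ζ ζ' : HilbertTensor σ F) :
    inner ℂ (amplify σ (m x) ζ) (amplify σ (m x') ζ') =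
      inner ℂ ζ (leftAction σ F h1 (ip x x') ζ') := by
  refine (denseRange_of σ).induction_on₂ (p := fun ζ ζ' =>
    inner ℂ (amplify σ (m x) ζ) (amplify σ (m x') ζ') =
      inner ℂ ζ (leftAction σ F h1 (ip x x') ζ')) ?_ (fun z z' => ?_) ζ ζ'
  · exact isClosed_eq (by fun_prop) (by fun_prop)
  · rw [amplify_of (norm_of_mul_le hm h1 x), amplify_of (norm_of_mul_le hm h1 x'),
      inner_of_mul hm h1]

end Multiplication

end LeftAction

end HilbertTensor

end HilbertTensor

/-! ### Weak-⋆ limits in a W⋆-algebra -/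

section WeakStarLimit

open Filter Topology

variable {A : Type*} [CStarAlgebra A]
variable {Y : Type*} [NormedAddCommGroup Y] [NormedSpace ℂ Y]
variable {ι : Type*}

/-- `l` is the weak-⋆ limit of the family `a` along the ultrafilter `𝒰`, for the predual `Y` of `A`
given by `φ`. -/
def IsWeakStarLimit (φ : StrongDual ℂ Y ≃ₗᵢ⋆[ℂ] A) (𝒰 : Ultrafilter ι) (a : ι → A) (l : A) : Prop :=
  ∀ p : Y, Tendsto (fun i => φ.symm (a i) p) 𝒰 (𝓝 (φ.symm l p))

namespace IsWeakStarLimit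

variable {φ : StrongDual ℂ Y ≃ₗᵢ⋆[ℂ] A} {𝒰 : Ultrafilter ι} {a b : ι → A} {l m : A}

lemma add (ha : IsWeakStarLimit φ 𝒰 a l) (hb : IsWeakStarLimit φ 𝒰 b m) :
    IsWeakStarLimit φ 𝒰 (fun i => a i + b i) (l + m) := fun p => by
  simpa using (ha p).add (hb p)

lemma sub (ha : IsWeakStarLimit φ 𝒰 a l) (hb : IsWeakStarLimit φ 𝒰 b m) :
    IsWeakStarLimit φ 𝒰 (fun i => a i - b i) (l - m) := fun p => by
  simpa using (ha p).sub (hb p)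

lemma smul (c : ℂ) (ha : IsWeakStarLimit φ 𝒰 a l) :
    IsWeakStarLimit φ 𝒰 (fun i => c • a i) (c • l) := fun p => by
  simpa [map_smulₛₗ] using (ha p).const_mul (starRingEnd ℂ c)

lemma const (φ : StrongDual ℂ Y ≃ₗᵢ⋆[ℂ] A) (𝒰 : Ultrafilter ι) (l : A) :
    IsWeakStarLimit φ 𝒰 (fun _ => l) l := fun _ => tendsto_const_nhds

lemma unique (ha : IsWeakStarLimit φ 𝒰 a l) (hb : IsWeakStarLimit φ 𝒰 a m) : l = m :=
  φ.symm.injective <| ContinuousLinearMap.ext fun p => tendsto_nhds_unique (ha p) (hb p)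

/-- The norm is lower semicontinuous for the weak-⋆ topology. -/
lemma norm_le {C : ℝ} (hC : 0 ≤ C) (ha : IsWeakStarLimit φ 𝒰 a l)
    (hb : ∀ᶠ i in 𝒰, ‖a i‖ ≤ C) : ‖l‖ ≤ C := by
  rw [← φ.symm.norm_map]
  refine ContinuousLinearMap.opNorm_le_bound _ hC fun p => ?_
  refine le_of_tendsto (ha p).norm (hb.mono fun i hi => ?_)
  refine ((φ.symm (a i)).le_opNorm p).trans ?_
  rw [φ.symm.norm_map]
  gcongr

/-- Bounded families have weak-⋆ limits, by the Banach-Alaoglu theorem. -/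
lemma exists_of_bounded (φ : StrongDual ℂ Y ≃ₗᵢ⋆[ℂ] A) (𝒰 : Ultrafilter ι) {a : ι → A} {C : ℝ}
    (hb : ∀ i, ‖a i‖ ≤ C) : ∃ l, IsWeakStarLimit φ 𝒰 a l := by
  obtain ⟨f, -, hf⟩ := (WeakDual.isCompact_closedBall (𝕜 := ℂ) (E := Y) 0 C).ultrafilter_le_nhds'
    (𝒰.map fun i => StrongDual.toWeakDual (φ.symm (a i)))
    (Ultrafilter.mem_map.mpr (Filter.Eventually.of_forall fun i => by simpa using hb i))
  refine ⟨φ (WeakDual.toStrongDual f), fun p => ?_⟩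
  rw [LinearIsometryEquiv.symm_apply_apply]
  exact ((WeakDual.eval_continuous p).tendsto f).comp hf

/-- Weak-⋆ limits of bounded families of self-adjoint elements are self-adjoint: if the imaginary
part of the limit had `t ≠ 0` in its spectrum, translating by a large multiple of `i` would violate
the lower semicontinuity of the norm. -/
lemma isSelfAdjoint {C : ℝ} (ha : IsWeakStarLimit φ 𝒰 a l) (hb : ∀ᶠ i in 𝒰, ‖a i‖ ≤ C)
    (hsa : ∀ᶠ i in 𝒰, IsSelfAdjoint (a i)) : IsSelfAdjoint l := by
  rcases subsingleton_or_nontrivial A with _ | _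
  · exact Subsingleton.elim _ _
  have key : ∀ n : ℝ, ‖((imaginaryPart l : selfAdjoint A) : A) + algebraMap ℝ A n‖ ^ 2 ≤
      C ^ 2 + n ^ 2 := by
    intro n
    set e : A := Complex.I • algebraMap ℝ A n with he
    have hl : ‖l + e‖ ≤ √(C ^ 2 + n ^ 2) := by
      refine (ha.add (const φ 𝒰 e)).norm_le (Real.sqrt_nonneg _) ?_
      filter_upwards [hb, hsa] with i hi hs
      refine Real.le_sqrt_of_sq_le ?_
      have h1 : star (a i + e) * (a i + e) = a i * a i + algebraMap ℝ A (n ^ 2) := by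
        have hn : star (algebraMap ℝ A n) = algebraMap ℝ A n := by
          rw [← algebraMap_star_comm, star_trivial]
        have hc : algebraMap ℝ A n * a i = a i * algebraMap ℝ A n := Algebra.commutes n (a i)
        rw [star_add, he, star_smul, hn, hs.star_eq, Complex.star_def, Complex.conj_I, add_mul,
          mul_add, mul_add, smul_mul_smul_comm, smul_mul_assoc, mul_smul_comm, hc]
        simp [pow_two]
      rw [pow_two, ← CStarRing.norm_star_mul_self, h1]
      refine (norm_add_le _ _).trans (add_le_add ?_ ?_)
      · have hC : 0 ≤ C := (norm_nonneg _).trans hi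
        exact (norm_mul_le _ _).trans (by rw [pow_two]; gcongr)
      · rw [norm_algebraMap', Real.norm_of_nonneg (sq_nonneg n)]
    have h2 : ((imaginaryPart l : selfAdjoint A) : A) + algebraMap ℝ A n =
        (imaginaryPart (l + e) : selfAdjoint A) := by
      rw [map_add, AddSubgroup.coe_add, he, imaginaryPart_I_smul]
      congr 1
      rw [IsSelfAdjoint.coe_realPart]
      rw [IsSelfAdjoint, ← algebraMap_star_comm, star_trivial]
    rw [h2]
    calc _ ≤ (√(C ^ 2 + n ^ 2)) ^ 2 := by
          gcongr
          exact (imaginaryPart.norm_le (l + e)).trans hl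
      _ = _ := Real.sq_sqrt (by positivity)
  have h0 : ((imaginaryPart l : selfAdjoint A) : A) = 0 := by
    refine CFC.eq_zero_of_spectrum_subset_zero (R := ℝ) _ ?_ (imaginaryPart l).2
    intro t ht
    by_contra ht0
    have ht0 : t ≠ 0 := ht0
    have h3 : ∀ n : ℝ, (t + n) ^ 2 ≤ C ^ 2 + n ^ 2 := fun n => by
      have h4 : t + n ∈ spectrum ℝ (((imaginaryPart l : selfAdjoint A) : A) + algebraMap ℝ A n) := by
        rw [add_comm _ (algebraMap ℝ A n)]
        exact (spectrum.add_mem_add_iff).mpr ht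
      have h5 := spectrum.norm_le_norm_of_mem h4
      refine le_trans ?_ (key n)
      rw [← sq_abs (t + n)]
      gcongr
      exact h5
    have h6 := h3 (C ^ 2 / t)
    have h7 : t * (C ^ 2 / t) = C ^ 2 := by field_simp
    have h8 : 0 < t ^ 2 := by positivity
    nlinarith [sq_nonneg C]
  rw [← realPart_add_I_smul_imaginaryPart l, h0, smul_zero, add_zero]
  exact (realPart l).2

variable [PartialOrder A] [StarOrderedRing A]

/-- Weak-⋆ limits of bounded families of positive elements are positive. -/
lemma nonneg {C : ℝ} (hC : 0 ≤ C) (ha : IsWeakStarLimit φ 𝒰 a l) (hb : ∀ᶠ i in 𝒰, ‖a i‖ ≤ C)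
    (hpos : ∀ᶠ i in 𝒰, 0 ≤ a i) : 0 ≤ l := by
  have hsa : IsSelfAdjoint l := ha.isSelfAdjoint hb (hpos.mono fun i hi => hi.isSelfAdjoint)
  have hCsa : IsSelfAdjoint (algebraMap ℝ A C) := by
    rw [IsSelfAdjoint, ← algebraMap_star_comm, star_trivial]
  have h1 : ‖algebraMap ℝ A C - l‖ ≤ C := by
    refine ((const φ 𝒰 (algebraMap ℝ A C)).sub ha).norm_le hC ?_
    filter_upwards [hb, hpos] with i hi hp
    have h2 : a i ≤ algebraMap ℝ A C := (CStarAlgebra.norm_le_iff_le_algebraMap _ hC hp).mp hi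
    refine (CStarAlgebra.norm_le_iff_le_algebraMap _ hC (sub_nonneg.mpr h2)).mpr ?_
    exact sub_le_self _ hp
  have h3 : algebraMap ℝ A C - l ≤ algebraMap ℝ A C :=
    ((hCsa.sub hsa).le_algebraMap_norm_self).trans (algebraMap_mono A h1)
  simpa using h3

/-- The weak-⋆ limit of a bounded decreasing family is its infimum. -/
lemma isGLB [Preorder ι] (h𝒰 : ∀ i, ∀ᶠ j in (𝒰 : Filter ι), i ≤ j) (ha : IsWeakStarLimit φ 𝒰 a l)
    (hanti : Antitone a) {C : ℝ} (hb : ∀ i, ‖a i‖ ≤ C) :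
    IsGLB (Set.range a) l := by
  constructor
  · rintro _ ⟨i, rfl⟩
    rw [← sub_nonneg]
    refine ((const φ 𝒰 (a i)).sub ha).nonneg (C := ‖a i‖ + |C|) (by positivity)
      (Eventually.of_forall fun j => (norm_sub_le _ _).trans
        (by gcongr; exact (hb j).trans (le_abs_self C))) ?_
    exact (h𝒰 i).mono fun j hj => sub_nonneg.mpr (hanti hj)
  · intro c hc
    rw [← sub_nonneg]
    refine (ha.sub (const φ 𝒰 c)).nonneg (C := |C| + ‖c‖) (by positivity)
      (Eventually.of_forall fun j => (norm_sub_le _ _).trans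
        (by gcongr; exact (hb j).trans (le_abs_self C))) ?_
    exact Eventually.of_forall fun j => sub_nonneg.mpr (hc ⟨j, rfl⟩)

end IsWeakStarLimit

end WeakStarLimit

/-! ### Resolvents of finite rank operators on a Hilbert module -/

namespace HilbertModule

section Basic

variable {A : Type*} [CStarAlgebra A] [PartialOrder A]
variable {E : Type*} [NormedAddCommGroup E] [NormedSpace ℂ E] [HilbertModule A E]

lemma ip_sub_right (x y z : E) : ip (A := A) x (y - z) = ip x y - ip x z := by
  rw [eq_sub_iff_add_eq, ← ip_add_right, sub_add_cancel]

lemma ip_sub_left (x y z : E) : ip (A := A) (x - y) z = ip (A := A) x z - ip y z := by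
  rw [eq_sub_iff_add_eq, ← ip_add_left, sub_add_cancel]

lemma eq_zero_of_ip_self {x : E} (h : ip (A := A) x x = 0) : x = 0 := by
  have := norm_sq_eq (A := A) x
  rw [h, norm_zero] at this
  simpa using this

lemma ext_ip {x y : E} (h : ∀ z : E, ip (A := A) z x = ip z y) : x = y := by
  refine sub_eq_zero.mp (eq_zero_of_ip_self (A := A) ?_)
  rw [ip_sub_right, h, sub_self]

lemma smul_rsmul (c : ℂ) (x : E) (a : A) : (c • x) <• a = c • (x <• a) :=
  ext_ip (A := A) fun z => by simp only [ip_rsmul, ip_smul_right, smul_mul_assoc]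

lemma rsmul_smul (c : ℂ) (x : E) (a : A) : x <• (c • a) = c • (x <• a) :=
  ext_ip (A := A) fun z => by simp only [ip_rsmul, ip_smul_right, mul_smul_comm]

lemma rsmul_add (x : E) (a b : A) : x <• (a + b) = x <• a + x <• b := by
  rw [MulOpposite.op_add, add_smul]

variable [StarOrderedRing A]

/-- The Cauchy-Schwarz inequality in a Hilbert module. -/
lemma norm_ip_le (x y : E) : ‖ip (A := A) x y‖ ≤ ‖x‖ * ‖y‖ := by
  rcases eq_or_ne x 0 with rfl | hx
  · rw [ip_zero_left]; simp
  set b : A := ip x y with hb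
  set t : ℝ := ‖x‖ ^ 2 with ht
  have htpos : 0 < t := by positivity
  have hstar : star b = ip y x := star_ip x y
  have h1 : ip (A := A) (x <• b - (t : ℂ) • y) (x <• b - (t : ℂ) • y) =
      star b * ip x x * b - t • (star b * b) - t • (star b * b) + t • t • ip y y := by
    simp only [ip_sub_left, ip_sub_right, ip_rsmul, ip_rsmul_left, ip_smul_left, ip_smul_right,
      ← hb, ← hstar, Complex.star_def, Complex.conj_ofReal, sub_mul, smul_sub, smul_mul_assoc]
    simp only [Complex.coe_smul]
    abel
  have h2 : star b * ip (A := A) x x * b ≤ t • (star b * b) := by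
    have := CStarAlgebra.star_left_conjugate_le_norm_smul (a := b) (b := ip (A := A) x x)
      (IsSelfAdjoint.of_nonneg (ip_self_nonneg x))
    rwa [← norm_sq_eq] at this
  have h3 : t • (star b * b) ≤ t • t • ip (A := A) y y := by
    have h4 := ip_self_nonneg (A := A) (x <• b - (t : ℂ) • y)
    rw [h1] at h4
    rw [← sub_nonneg]
    refine h4.trans ?_
    have := sub_nonneg.mpr h2
    rw [← sub_nonneg]
    refine this.trans_eq ?_
    abel
  have h5 : star b * b ≤ t • ip (A := A) y y := by
    rwa [smul_le_smul_iff_of_pos_left htpos] at h3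
  have h6 := CStarAlgebra.norm_le_norm_of_nonneg_of_le (star_mul_self_nonneg b) h5
  rw [CStarRing.norm_star_mul_self, norm_smul, ← norm_sq_eq, Real.norm_of_nonneg htpos.le, ht]
    at h6
  refine le_of_sq_le_sq ?_ (by positivity)
  rw [mul_pow]
  nlinarith

end Basic

section Resolvent

variable {A : Type*} [CStarAlgebra A] [PartialOrder A]
variable {E : Type*} [NormedAddCommGroup E] [NormedSpace ℂ E] [HilbertModule A E]
variable {ι : Type*} (v : ι → E) (s : Finset ι)

variable (A) in
/-- The positive finite rank operator `z ↦ ∑ v_i ⟨v_i, z⟩`. -/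
def frame (z : E) : E := ∑ i ∈ s, v i <• ip (A := A) (v i) z

lemma ip_frame (x z : E) : ip (A := A) x (frame A v s z) = ∑ i ∈ s, ip x (v i) * ip (v i) z := by
  simp only [frame, ip_sum_right, ip_rsmul]

lemma ip_frame_left (x z : E) :
    ip (A := A) (frame A v s x) z = ip x (frame A v s z) := by
  rw [← star_ip, ip_frame, ip_frame, star_sum]
  simp only [star_mul, star_ip]

lemma frame_sub (x z : E) : frame A v s (x - z) = frame A v s x - frame A v s z := by
  refine ext_ip (A := A) fun y => ?_
  simp only [ip_sub_right, ip_frame, mul_sub, Finset.sum_sub_distrib]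

lemma frame_add (x z : E) : frame A v s (x + z) = frame A v s x + frame A v s z := by
  refine ext_ip (A := A) fun y => ?_
  simp only [ip_add_right, ip_frame, mul_add, Finset.sum_add_distrib]

lemma frame_smul (c : ℂ) (z : E) : frame A v s (c • z) = c • frame A v s z := by
  refine ext_ip (A := A) fun y => ?_
  simp only [ip_smul_right, ip_frame, mul_smul_comm, Finset.smul_sum]

lemma frame_rsmul (z : E) (a : A) : frame A v s (z <• a) = frame A v s z <• a := by
  refine ext_ip (A := A) fun y => ?_
  simp only [ip_rsmul, ip_frame, ← mul_assoc, Finset.sum_mul]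

variable [StarOrderedRing A]

lemma ip_frame_mono {s t : Finset ι} (hst : s ⊆ t) (z : E) :
    ip (A := A) z (frame A v s z) ≤ ip z (frame A v t z) := by
  rw [ip_frame, ip_frame]
  refine Finset.sum_le_sum_of_subset_of_nonneg hst fun i _ _ => ?_
  rw [← star_ip (v i) z]
  exact star_mul_self_nonneg _

lemma ip_frame_nonneg (z : E) : 0 ≤ ip (A := A) z (frame A v s z) := by
  simpa [ip_frame] using ip_frame_mono (A := A) v (Finset.empty_subset s) z

/-- `1 + ∑ v_i ⟨v_i, ·⟩` is onto: vectors are added one at a time, by the formula for the inverse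
of a rank one perturbation. -/
lemma exists_add_frame_eq (x : E) : ∃ z, z + frame A v s z = x := by
  classical
  induction s using Finset.induction_on generalizing x with
  | empty => exact ⟨x, by simp [frame]⟩
  | insert i s hi ih =>
    obtain ⟨p, hp⟩ := ih x
    obtain ⟨q, hq⟩ := ih (v i)
    set d : A := ip (v i) q with hd
    have hdpos : 0 ≤ d := by
      have : d = ip q q + ip q (frame A v s q) := by
        rw [hd, ← ip_add_right, hq, ← star_ip q (v i), ← hq, ip_add_right, star_add, star_ip,
          star_ip, ip_frame_left]
      rw [this]
      exact add_nonneg (ip_self_nonneg q) (ip_frame_nonneg v s q)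
    obtain ⟨e, he⟩ : IsUnit (1 + d) :=
      CStarAlgebra.isUnit_of_le 1 (by simpa using hdpos)
    set c : A := (e⁻¹ : Aˣ) * ip (v i) p with hc
    have hdc : c + d * c = ip (v i) p := by
      rw [← one_add_mul, ← he, hc, Units.mul_inv_cancel_left]
    refine ⟨p - q <• c, ?_⟩
    have h1 : frame A v (insert i s) (p - q <• c) =
        v i <• ip (v i) (p - q <• c) + frame A v s (p - q <• c) := Finset.sum_insert hi
    refine ext_ip (A := A) fun y => ?_
    rw [h1, frame_sub, frame_rsmul]
    have h2 := congrArg (ip (A := A) y) hp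
    have h3 := congrArg (fun w => ip (A := A) y w * c) hq
    simp only [ip_add_right, ip_sub_right, ip_rsmul, add_mul, ← hd] at h2 h3 ⊢
    rw [← h2, ← hdc, add_sub_cancel_right, ← h3]
    abel

lemma eq_zero_of_add_frame {z : E} (h : z + frame A v s z = 0) : z = 0 := by
  refine eq_zero_of_ip_self (A := A) (le_antisymm ?_ (ip_self_nonneg z))
  have h1 := congrArg (ip (A := A) z) h
  rw [ip_add_right, ip_zero_right] at h1
  rw [← h1]
  exact le_add_of_nonneg_right (ip_frame_nonneg v s z)

lemma add_frame_injective {z z' : E} (h : z + frame A v s z = z' + frame A v s z') : z = z' := by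
  refine sub_eq_zero.mp (eq_zero_of_add_frame (A := A) v s ?_)
  rw [frame_sub, sub_add_sub_comm, h, sub_self]

variable (A) in
/-- The resolvent `(1 + ∑ v_i ⟨v_i, ·⟩)⁻¹`. -/
noncomputable def resolvent (x : E) : E := (exists_add_frame_eq (A := A) v s x).choose

lemma resolvent_add_frame (x : E) : resolvent A v s x + frame A v s (resolvent A v s x) = x :=
  (exists_add_frame_eq (A := A) v s x).choose_spec

lemma resolvent_add (x y : E) :
    resolvent A v s (x + y) = resolvent A v s x + resolvent A v s y := by
  refine add_frame_injective (A := A) v s ?_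
  rw [resolvent_add_frame, frame_add, add_add_add_comm, resolvent_add_frame, resolvent_add_frame]

lemma resolvent_smul (c : ℂ) (x : E) : resolvent A v s (c • x) = c • resolvent A v s x := by
  refine add_frame_injective (A := A) v s ?_
  rw [resolvent_add_frame, frame_smul, ← smul_add, resolvent_add_frame]

lemma resolvent_rsmul (x : E) (a : A) : resolvent A v s (x <• a) = resolvent A v s x <• a := by
  refine add_frame_injective (A := A) v s ?_
  rw [resolvent_add_frame, frame_rsmul, ← smul_add, resolvent_add_frame]

lemma ip_resolvent_left (x y : E) :
    ip (A := A) (resolvent A v s x) y = ip x (resolvent A v s y) := by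
  conv_lhs => rw [← resolvent_add_frame (A := A) v s y]
  conv_rhs => rw [← resolvent_add_frame (A := A) v s x]
  rw [ip_add_right, ip_add_left, ip_frame_left]

lemma ip_resolvent_self (x : E) : ip (A := A) x (resolvent A v s x) =
    ip (resolvent A v s x) (resolvent A v s x) +
      ip (resolvent A v s x) (frame A v s (resolvent A v s x)) := by
  rw [← ip_add_right, resolvent_add_frame, ip_resolvent_left]

lemma ip_resolvent_resolvent_le (x : E) :
    ip (A := A) (resolvent A v s x) (resolvent A v s x) ≤ ip x (resolvent A v s x) := by
  rw [ip_resolvent_self]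
  exact le_add_of_nonneg_right (ip_frame_nonneg v s _)

lemma ip_resolvent_nonneg (x : E) : 0 ≤ ip (A := A) x (resolvent A v s x) :=
  (ip_self_nonneg _).trans (ip_resolvent_resolvent_le v s x)

variable (A) in
lemma norm_resolvent_le (x : E) : ‖resolvent A v s x‖ ≤ ‖x‖ := by
  have h1 := CStarAlgebra.norm_le_norm_of_nonneg_of_le (ip_self_nonneg _)
    (ip_resolvent_resolvent_le (A := A) v s x)
  rw [← norm_sq_eq] at h1
  have h2 := h1.trans (norm_ip_le x _)
  by_contra! h
  nlinarith [norm_nonneg x]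

lemma norm_ip_resolvent_le (x y : E) : ‖ip (A := A) x (resolvent A v s y)‖ ≤ ‖x‖ * ‖y‖ :=
  (norm_ip_le _ _).trans (by gcongr; exact norm_resolvent_le A v s y)

/-- Enlarging the frame decreases the resolvent. -/
lemma ip_resolvent_antitone (x : E) :
    Antitone fun s : Finset ι => ip (A := A) x (resolvent A v s x) := by
  intro s t hst
  set p := resolvent A v s x with hp
  set q := resolvent A v t x with hq
  have hS : p + frame A v s p = x := resolvent_add_frame v s x
  have hT : q + frame A v t q = x := resolvent_add_frame v t x
  have h1 : 0 ≤ ip (A := A) (p - q) ((p - q) + frame A v s (p - q)) := by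
    rw [ip_add_right]
    exact add_nonneg (ip_self_nonneg _) (ip_frame_nonneg v s _)
  have h2 : ip (A := A) q (q + frame A v s q) ≤ ip x q := by
    have : ip (A := A) x q = ip q x := ip_resolvent_left v t x x |>.symm
    rw [this, ip_add_right]
    conv_rhs => rw [← hT, ip_add_right]
    gcongr
    exact ip_frame_mono v hst q
  have h3 : ip (A := A) p (q + frame A v s q) = ip x q := by
    rw [ip_add_right, ← ip_frame_left, ← ip_add_left, hS]
  have h4 : ip (A := A) q x = ip x q := ip_resolvent_left v t x x
  have h5 : ip (A := A) p x = ip x p := ip_resolvent_left v s x x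
  have h6 : (p - q) + frame A v s (p - q) = x - (q + frame A v s q) := by
    rw [frame_sub, sub_add_sub_comm, hS]
  rw [h6, ip_sub_right, ip_sub_left, ip_sub_left, h3, h4, h5] at h1
  change ip (A := A) x q ≤ ip x p
  rw [← sub_nonneg]
  refine h1.trans ?_
  exact sub_le_self _ (sub_nonneg.mpr h2)

/-- The resolvent of a frame containing a large multiple `c y` of `y` nearly annihilates `y`. -/
lemma norm_ip_resolvent_le_of_mem {i : ι} (hi : i ∈ s) {y : E} {c : ℝ} (hc : 0 < c)
    (hy : v i = (c : ℂ) • y) : ‖ip (A := A) y (resolvent A v s y)‖ ≤ (c ^ 2)⁻¹ := by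
  set z := resolvent A v s y with hz
  set b : A := ip y z with hb
  have h1 : star (ip (A := A) (v i) z) * ip (v i) z ≤ b := by
    rw [hb, hz, ip_resolvent_self, ← hz]
    refine le_trans ?_ (le_add_of_nonneg_left (ip_self_nonneg z))
    rw [ip_frame]
    refine le_trans (le_of_eq (by rw [star_ip])) (Finset.single_le_sum
      (f := fun i => ip (A := A) z (v i) * ip (v i) z) (fun j _ => ?_) hi)
    change 0 ≤ ip (A := A) z (v j) * ip (v j) z
    rw [← star_ip (v j) z]
    exact star_mul_self_nonneg _
  have h2 := CStarAlgebra.norm_le_norm_of_nonneg_of_le (star_mul_self_nonneg _) h1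
  rw [CStarRing.norm_star_mul_self, hy, ip_smul_left, Complex.star_def, Complex.conj_ofReal,
    ← hb, norm_smul, Complex.norm_real, Real.norm_of_nonneg hc.le] at h2
  rcases (norm_nonneg b).eq_or_lt with h0 | h0
  · rw [← h0]; positivity
  · rw [le_inv_comm₀ h0 (by positivity)]
    rw [← one_div, le_div_iff₀ h0]
    nlinarith

end Resolvent

end HilbertModule

/-! ### Density of submodules with trivial annihilator in a self-dual module -/

section SelfDual

open Filter Topology HilbertModule

variable {A : Type*} [CStarAlgebra A]

/-- A sesquilinear map that vanishes on the diagonal vanishes. -/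
lemma sesq_eq_zero_of_diag {E M : Type*} [AddCommGroup E] [Module ℂ E] [AddCommGroup M] [Module ℂ M]
    {D : E → E → M} (hadd_right : ∀ x y z, D x (y + z) = D x y + D x z)
    (hadd_left : ∀ x y z, D (x + y) z = D x z + D y z)
    (hsmul_right : ∀ (c : ℂ) x y, D x (c • y) = c • D x y)
    (hsmul_left : ∀ (c : ℂ) x y, D (c • x) y = star c • D x y)
    (hdiag : ∀ x, D x x = 0) (x y : E) : D x y = 0 := by
  have h1 : ∀ y, D x y + D y x = 0 := fun y => by
    have := hdiag (x + y)
    rwa [hadd_right, hadd_left, hadd_left, hdiag, hdiag, zero_add, add_zero, add_comm] at this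
  have h2 := h1 (Complex.I • y)
  rw [hsmul_right, hsmul_left, Complex.star_def, Complex.conj_I, neg_smul, ← sub_eq_add_neg,
    ← smul_sub, smul_eq_zero_iff_right Complex.I_ne_zero, sub_eq_zero] at h2
  have h3 := h1 y
  rw [← h2, ← two_smul ℂ] at h3
  exact (smul_eq_zero_iff_right two_ne_zero).mp h3

variable [PartialOrder A] [StarOrderedRing A]

/-- Conjugation by an invertible element preserves infima. -/
lemma IsGLB.star_conjugate {ι : Type*} {a : ι → A} {l : A} (h : IsGLB (Set.range a) l) (b : Aˣ) :
    IsGLB (Set.range fun i => star (b : A) * a i * b) (star (b : A) * l * b) := by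
  constructor
  · rintro _ ⟨i, rfl⟩
    exact star_left_conjugate_le_conjugate (h.1 ⟨i, rfl⟩) _
  · intro c hc
    have h1 : star ((b⁻¹ : Aˣ) : A) * c * (b⁻¹ : Aˣ) ≤ l := by
      refine h.2 ?_
      rintro _ ⟨i, rfl⟩
      have h2 := star_left_conjugate_le_conjugate (hc ⟨i, rfl⟩) ((b⁻¹ : Aˣ) : A)
      refine h2.trans_eq ?_
      rw [mul_assoc, mul_assoc, mul_assoc, Units.mul_inv, mul_one, ← mul_assoc, ← star_mul,
        Units.mul_inv, star_one, one_mul]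
    refine le_trans (le_of_eq ?_) (star_left_conjugate_le_conjugate h1 (b : A))
    rw [mul_assoc, mul_assoc, mul_assoc, Units.inv_mul, mul_one, ← mul_assoc, ← star_mul,
      Units.inv_mul, star_one, one_mul]

variable {E : Type*} [NormedAddCommGroup E] [NormedSpace ℂ E] [HilbertModule A E]

omit [StarOrderedRing A] in
/-- A sesquilinear form on a Hilbert module that is compatible with the action of invertible
elements is `A`-linear: expand the identity for the invertible elements `1 + ε a` with `‖a‖ < 1`
and `ε ∈ {1, -1, i}`, and compare coefficients. -/
lemma sesq_rsmul_of_units {B : E → E → A} (hadd_right : ∀ x y z, B x (y + z) = B x y + B x z)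
    (hadd_left : ∀ x y z, B (x + y) z = B x z + B y z)
    (hsmul_right : ∀ (c : ℂ) x y, B x (c • y) = c • B x y)
    (hsmul_left : ∀ (c : ℂ) x y, B (c • x) y = star c • B x y)
    (hunit : ∀ (b : Aˣ) x, B (x <• (b : A)) (x <• (b : A)) = star (b : A) * B x x * b)
    (x y : E) (a : A) : B x (y <• a) = B x y * a := by
  have hpol : ∀ (b : Aˣ) x y, B (x <• (b : A)) (y <• (b : A)) = star (b : A) * B x y * b := by
    intro b x y
    refine sub_eq_zero.mp (sesq_eq_zero_of_diag
      (D := fun x y => B (x <• (b : A)) (y <• (b : A)) - star (b : A) * B x y * b)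
      ?_ ?_ ?_ ?_ ?_ x y)
    · intro x y z
      simp only [smul_add, hadd_right, mul_add, add_mul]; abel
    · intro x y z
      simp only [smul_add, hadd_left, mul_add, add_mul]; abel
    · intro c x y
      simp only [smul_rsmul, hsmul_right, mul_smul_comm, smul_mul_assoc, smul_sub]
    · intro c x y
      simp only [smul_rsmul, hsmul_left, mul_smul_comm, smul_mul_assoc, smul_sub]
    · intro x
      exact sub_eq_zero.mpr (hunit b x)
  have hsmall : ∀ a : A, ‖a‖ < 1 → B x (y <• a) = B x y * a := by
    intro a ha
    set D0 := B (x <• a) (y <• a) - star a * B x y * a with hD0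
    set D1 := B x (y <• a) - B x y * a with hD1
    set D2 := B (x <• a) y - star a * B x y with hD2
    have hε : ∀ ε : ℂ, ‖ε‖ = 1 → (star ε * ε) • D0 + ε • D1 + star ε • D2 = 0 := by
      intro ε hε
      have hu : IsUnit (1 + ε • a) := by
        have : ‖-(ε • a)‖ < 1 := by rwa [norm_neg, norm_smul, hε, one_mul]
        simpa using isUnit_one_sub_of_norm_lt_one this
      obtain ⟨b, hb⟩ := hu
      have h1 := hpol b x y
      rw [hb] at h1
      simp only [rsmul_add, rsmul_smul, MulOpposite.op_one, one_smul, hadd_left, hadd_right,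
        hsmul_left, hsmul_right, star_add, star_one, star_smul, add_mul, mul_add, one_mul, mul_one,
        smul_mul_assoc, mul_smul_comm, smul_smul] at h1
      rw [← sub_eq_zero] at h1
      simp only [hD0, hD1, hD2, smul_sub]
      rw [← h1, smul_add, smul_smul, mul_comm ε]
      abel
    have e1 := hε 1 (by simp)
    have e2 := hε (-1) (by simp)
    have e3 := hε Complex.I (by simp)
    simp only [star_one, one_mul, one_smul, star_neg, neg_mul, mul_neg, neg_neg, neg_smul,
      Complex.star_def, Complex.conj_I, Complex.I_mul_I] at e1 e2 e3
    have e4 : D0 = 0 := by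
      have : (2 : ℂ) • D0 = (D0 + D1 + D2) + (D0 + -D1 + -D2) := by rw [two_smul]; abel
      rw [e1, e2, add_zero] at this
      exact (smul_eq_zero_iff_right two_ne_zero).mp this
    rw [e4, zero_add, ← sub_eq_add_neg, ← smul_sub,
      smul_eq_zero_iff_right Complex.I_ne_zero, sub_eq_zero] at e3
    rw [e4, zero_add, ← e3, ← two_smul ℂ] at e1
    exact sub_eq_zero.mp ((smul_eq_zero_iff_right two_ne_zero).mp e1)
  have hpos : (0 : ℝ) < ‖a‖ + 1 := by positivity
  set c : ℂ := (((‖a‖ + 1)⁻¹ : ℝ) : ℂ) with hc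
  have hc0 : c ≠ 0 := by rw [hc, Complex.ofReal_ne_zero]; positivity
  have h1 := hsmall (c • a) (by
    rw [norm_smul, hc, Complex.norm_real, Real.norm_of_nonneg (by positivity),
      inv_mul_lt_one₀ hpos]
    exact lt_add_one _)
  rw [rsmul_smul, hsmul_right, mul_smul_comm] at h1
  exact smul_right_injective A hc0 h1

/-- For a submodule `F` of a self-dual module over a W⋆-algebra that is annihilated only by `0`, the
resolvents `(1 + ∑ y ⟨y, ·⟩)⁻¹` over finite subsets of `F` decrease to `0`: their weak-⋆ limit
along an ultrafilter is an `A`-valued form that vanishes on `F`, and self-duality represents it by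
vectors annihilated by `F`. -/
theorem isGLB_ip_resolvent [WStarAlgebra A]
    (hE : ∀ τ : E →L[ℂ] A, (∀ (x : E) (a : A), τ (x <• a) = τ x * a) →
      ∃ y : E, ∀ x, τ x = ip y x)
    (F : Submodule ℂ E) (hF : ∀ g : E, (∀ y ∈ F, ip (A := A) g y = 0) → g = 0) (x : E) :
    IsGLB (Set.range fun s : Finset F =>
      ip (A := A) x (resolvent A (fun y : F => (y : E)) s x)) 0 := by
  obtain ⟨Y, _, _, _, ⟨φ⟩⟩ := WStarAlgebra.exists_predual (M := A)
  set R : Finset F → E → E := fun s x => resolvent A (fun y : F => (y : E)) s x with hR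
  let 𝒰 : Ultrafilter (Finset F) := Ultrafilter.of atTop
  have h𝒰 : ∀ s, ∀ᶠ t in (𝒰 : Filter (Finset F)), s ≤ t := fun s =>
    (Ultrafilter.of_le atTop) (eventually_ge_atTop s)
  have hex : ∀ x y : E, ∃ l, IsWeakStarLimit φ 𝒰 (fun s => ip (A := A) x (R s y)) l :=
    fun x y => IsWeakStarLimit.exists_of_bounded φ 𝒰 (C := ‖x‖ * ‖y‖)
      fun s => norm_ip_resolvent_le _ s x y
  choose B hB using hex
  have hadd_right : ∀ x y z, B x (y + z) = B x y + B x z := fun x y z =>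
    (hB x (y + z)).unique (by
      simpa only [hR, resolvent_add, ip_add_right] using (hB x y).add (hB x z))
  have hadd_left : ∀ x y z, B (x + y) z = B x z + B y z := fun x y z =>
    (hB (x + y) z).unique (by
      simpa only [ip_add_left] using (hB x z).add (hB y z))
  have hsmul_right : ∀ (c : ℂ) x y, B x (c • y) = c • B x y := fun c x y =>
    (hB x (c • y)).unique (by
      simpa only [hR, resolvent_smul, ip_smul_right] using (hB x y).smul c)
  have hsmul_left : ∀ (c : ℂ) x y, B (c • x) y = star c • B x y := fun c x y =>
    (hB (c • x) y).unique (by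
      simpa only [ip_smul_left] using (hB x y).smul (star c))
  have hglb : ∀ x, IsGLB (Set.range fun s => ip (A := A) x (R s x)) (B x x) := fun x =>
    (hB x x).isGLB h𝒰 (ip_resolvent_antitone _ x) (C := ‖x‖ * ‖x‖)
      fun s => norm_ip_resolvent_le _ s x x
  have hunit : ∀ (b : Aˣ) x, B (x <• (b : A)) (x <• (b : A)) = star (b : A) * B x x * b := by
    intro b x
    refine (hglb (x <• (b : A))).unique ?_
    have := IsGLB.star_conjugate (hglb x) b
    simpa only [hR, resolvent_rsmul, ip_rsmul, ip_rsmul_left, mul_assoc] using this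
  have hBlin := sesq_rsmul_of_units hadd_right hadd_left hsmul_right hsmul_left hunit
  have hbound : ∀ x y, ‖B x y‖ ≤ ‖x‖ * ‖y‖ := fun x y =>
    (hB x y).norm_le (by positivity) (Eventually.of_forall fun s => norm_ip_resolvent_le _ s x y)
  -- the limit form vanishes on `F`, since large multiples of `y` eventually enter the frame
  have hcross : ∀ y ∈ F, B x y = 0 := by
    intro y hy
    refine norm_le_zero_iff.mp (le_of_forall_pos_le_add fun ε hε => ?_)
    set δ : ℝ := ε / (‖x‖ + 1) with hδ
    have hδpos : 0 < δ := by positivity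
    have hc : (0 : ℝ) < √(δ ^ 2)⁻¹ := by positivity
    set z : F := ⟨((√(δ ^ 2)⁻¹ : ℝ) : ℂ) • y, F.smul_mem _ hy⟩ with hz
    have hev : ∀ᶠ s in (𝒰 : Filter (Finset F)), ‖ip (A := A) x (R s y)‖ ≤ ε := by
      filter_upwards [h𝒰 {z}] with s hs
      have h1 := norm_ip_resolvent_le_of_mem (A := A) (fun y : F => (y : E)) s (i := z)
        (Finset.singleton_subset_iff.mp hs) hc (y := y) rfl
      rw [Real.sq_sqrt (by positivity), inv_inv] at h1
      have h2 := CStarAlgebra.norm_le_norm_of_nonneg_of_le (ip_self_nonneg _)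
        (ip_resolvent_resolvent_le (A := A) (fun y : F => (y : E)) s y)
      rw [← norm_sq_eq] at h2
      have h3 : ‖R s y‖ ≤ δ := le_of_sq_le_sq (h2.trans h1) hδpos.le
      calc ‖ip (A := A) x (R s y)‖ ≤ ‖x‖ * ‖R s y‖ := norm_ip_le _ _
        _ ≤ (‖x‖ + 1) * δ := by gcongr; linarith
        _ = ε := by rw [hδ]; field_simp
    simpa using (hB x y).norm_le hε.le hev
  have hzero : B x x = 0 := by
    let τ : E →L[ℂ] A := LinearMap.mkContinuous
      { toFun := B x, map_add' := hadd_right x, map_smul' := fun c y => hsmul_right c x y }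
      ‖x‖ (hbound x)
    obtain ⟨g, hg⟩ := hE τ (hBlin x)
    have hg0 : g = 0 := hF g fun y hy => (hg y).symm.trans (hcross y hy)
    have := hg x
    rw [hg0, ip_zero_left] at this
    exact this
  rw [← hzero]
  exact hglb x

variable {H : Type*} [NormedAddCommGroup H] [InnerProductSpace ℂ H] [CompleteSpace H]

/-- If `F` is a submodule of a self-dual module `E` over a W⋆-algebra that is annihilated only by
`0`, then the tensors `y ⊗ h` with `y ∈ F` span a dense subspace of `E ⊗_σ H` for every normal
representation `σ`. -/
theorem topologicalClosure_span_tmul_of_selfDual [WStarAlgebra A]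
    (hE : ∀ τ : E →L[ℂ] A, (∀ (x : E) (a : A), τ (x <• a) = τ x * a) →
      ∃ y : E, ∀ x, τ x = ip y x)
    (F : Submodule ℂ E) (hFA : ∀ y ∈ F, ∀ a : A, y <• a ∈ F)
    (hF : ∀ g : E, (∀ y ∈ F, ip (A := A) g y = 0) → g = 0)
    (σ : A →⋆ₙₐ[ℂ] (H →L[ℂ] H)) (hσ : IsNormal σ) :
    (Submodule.span ℂ {ζ : HilbertTensor σ E |
      ∃ y ∈ F, ∃ h, ζ = HilbertTensor.tmul σ y h}).topologicalClosure = ⊤ := by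
  set M := (Submodule.span ℂ {ζ : HilbertTensor σ E |
      ∃ y ∈ F, ∃ h, ζ = HilbertTensor.tmul σ y h}).topologicalClosure with hM
  refine HilbertTensor.eq_top_of_tmul_mem (Submodule.isClosed_topologicalClosure _) fun x h => ?_
  set R : Finset F → E := fun s => resolvent A (fun y : F => (y : E)) s x with hR
  have hglb := isGLB_ip_resolvent hE F hF x
  have hmem : ∀ s, HilbertTensor.tmul σ (x - R s) h ∈ M := by
    intro s
    refine Submodule.le_topologicalClosure _ (Submodule.subset_span ⟨_, ?_, h, rfl⟩)
    have h1 : x - R s = frame A (fun y : F => (y : E)) s (R s) :=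
      sub_eq_iff_eq_add'.mpr (resolvent_add_frame _ s x).symm
    rw [h1]
    exact Submodule.sum_mem _ fun y _ => hFA _ y.2 _
  -- normality turns the order limit into a limit of norms
  have hlim : ∀ ε : ℝ, 0 < ε → ∃ s, ‖HilbertTensor.tmul σ (R s) h‖ ^ 2 < ε := by
    intro ε hε
    have hN := hσ (Set.range fun s => -ip (A := A) x (R s)) 0 (Set.range_nonempty _) ?_ ?_ ?_ h
    · obtain ⟨_, ⟨_, ⟨s, rfl⟩, rfl⟩, hs⟩ := (lt_isLUB_iff hN).mp
        (show -ε < (inner ℂ h (σ 0 h) : ℂ).re by simpa using hε)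
      refine ⟨s, ?_⟩
      have h1 : ‖HilbertTensor.tmul σ (R s) h‖ ^ 2 =
          (inner ℂ h (σ (ip (R s) (R s)) h) : ℂ).re := by
        rw [← HilbertTensor.inner_tmul, ← inner_self_eq_norm_sq (𝕜 := ℂ)]; rfl
      have h2 : (inner ℂ h (σ (ip (R s) (R s)) h) : ℂ).re ≤
          (inner ℂ h (σ (ip x (R s)) h) : ℂ).re := by
        obtain ⟨b, hb⟩ := CStarAlgebra.nonneg_iff_eq_star_mul_self.mp
          (sub_nonneg.mpr (ip_resolvent_resolvent_le (A := A) (fun y : F => (y : E)) s x))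
        rw [← sub_nonneg, ← Complex.sub_re, ← inner_sub_right, ← sub_apply, ← map_sub, hb,
          map_mul, map_star, mul_apply_eq_comp, ContinuousLinearMap.star_eq_adjoint,
          ContinuousLinearMap.adjoint_inner_right]
        exact inner_self_nonneg (𝕜 := ℂ)
      rw [h1]
      refine h2.trans_lt ?_
      simp only [map_neg, neg_apply, inner_neg_right, Complex.neg_re] at hs
      linarith
    · rintro _ ⟨s, rfl⟩ _ ⟨t, rfl⟩
      classical
      refine ⟨_, ⟨s ∪ t, rfl⟩, ?_, ?_⟩
      · exact neg_le_neg (ip_resolvent_antitone _ x Finset.subset_union_left)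
      · exact neg_le_neg (ip_resolvent_antitone _ x Finset.subset_union_right)
    · rintro _ ⟨s, rfl⟩
      exact (IsSelfAdjoint.of_nonneg (ip_resolvent_nonneg _ s x)).neg
    · constructor
      · rintro _ ⟨s, rfl⟩
        exact neg_nonpos.mpr (ip_resolvent_nonneg _ s x)
      · intro c hc
        have : -c ≤ 0 := hglb.2 (by
          rintro _ ⟨s, rfl⟩
          exact neg_le.mp (hc ⟨s, rfl⟩))
        exact neg_nonpos.mp this
  have hcl : HilbertTensor.tmul σ x h ∈ closure (M : Set (HilbertTensor σ E)) := by
    refine Metric.mem_closure_iff.mpr fun ε hε => ?_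
    obtain ⟨s, hs⟩ := hlim (ε ^ 2) (by positivity)
    refine ⟨_, hmem s, ?_⟩
    rw [dist_eq_norm]
    have : HilbertTensor.tmul σ x h - HilbertTensor.tmul σ (x - R s) h =
        HilbertTensor.tmul σ (R s) h := by
      simp only [← HilbertTensor.mk_apply, map_sub, LinearMap.sub_apply, sub_sub_cancel]
    rw [this]
    exact lt_of_pow_lt_pow_left₀ 2 hε.le hs
  rwa [IsClosed.closure_eq (Submodule.isClosed_topologicalClosure _)] at hcl

end SelfDual

/-! ### Direct limits of Hilbert spaces along isometries -/

section HilbertDirectLimit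

variable {ι : Type u} [Preorder ι] [IsDirectedOrder ι] [Nonempty ι]
variable {G : ι → Type v} [∀ i, NormedAddCommGroup (G i)] [∀ i, InnerProductSpace ℂ (G i)]
variable (f : ∀ i j, i ≤ j → G i →ₗᵢ[ℂ] G j) [DirectedSystem G (f · · ·)]

/-- The inner product on the algebraic direct limit of a directed system of inner product spaces
and isometries. -/
noncomputable abbrev directLimitCore : PreInnerProductSpace.Core ℂ (DirectLimit G f) where
  inner := DirectLimit.lift₂ f f (fun _ x y => inner ℂ x y)
    fun i j h x y => ((f i j h).inner_map_map x y).symm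
  conj_inner_symm := DirectLimit.induction₂ f fun i x y => by
    rw [DirectLimit.lift₂_def, DirectLimit.lift₂_def, inner_conj_symm]
  re_inner_nonneg := DirectLimit.induction f fun i x => by
    rw [DirectLimit.lift₂_def]; exact inner_self_nonneg
  add_left := DirectLimit.induction₃ f fun i x y z => by
    rw [DirectLimit.add_def, DirectLimit.lift₂_def, DirectLimit.lift₂_def, DirectLimit.lift₂_def,
      inner_add_left]
  smul_left := DirectLimit.induction₂ f fun i x y c => by
    rw [DirectLimit.smul_def, DirectLimit.lift₂_def, DirectLimit.lift₂_def, inner_smul_left]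

/-- A directed system of inner product spaces and isometries has a limit Hilbert space. -/
theorem exists_hilbert_directLimit : ∃ (K : Type (max u v)) (_ : NormedAddCommGroup K)
    (_ : InnerProductSpace ℂ K) (_ : CompleteSpace K) (e : ∀ i, G i →ₗᵢ[ℂ] K),
    (∀ i j h x, e j (f i j h x) = e i x) ∧ Dense (⋃ i, Set.range (e i)) := by
  let _ : SeminormedAddCommGroup (DirectLimit G f) :=
    InnerProductSpace.Core.toSeminormedAddCommGroup (c := directLimitCore f)
  let _ : InnerProductSpace ℂ (DirectLimit G f) := InnerProductSpace.ofCore (directLimitCore f)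
  have hinner : ∀ i (x y : G i), inner ℂ (DirectLimit.Module.of ℂ ι G f i x)
      (DirectLimit.Module.of ℂ ι G f i y) = inner ℂ x y :=
    fun i x y => DirectLimit.lift₂_def f f (fun _ x y => inner ℂ x y)
      (fun i j h x y => ((f i j h).inner_map_map x y).symm) i x y
  let e (i : ι) : G i →ₗᵢ[ℂ] UniformSpace.Completion (DirectLimit G f) :=
    UniformSpace.Completion.toComplₗᵢ.comp
      ((DirectLimit.Module.of ℂ ι G f i).isometryOfInner (hinner i))
  refine ⟨UniformSpace.Completion (DirectLimit G f), inferInstance, inferInstance, inferInstance,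
    e, ?_, ?_⟩
  · intro i j h x
    exact congrArg (fun z : DirectLimit G f => (z : UniformSpace.Completion (DirectLimit G f)))
      (DirectLimit.mk_apply i j x h)
  · refine (UniformSpace.Completion.denseRange_coe (α := DirectLimit G f)).mono ?_
    rintro _ ⟨z, rfl⟩
    obtain ⟨i, x, rfl⟩ := DirectLimit.exists_eq_mk f z
    exact Set.mem_iUnion.mpr ⟨i, x, rfl⟩

variable {f}
variable {K : Type*} [NormedAddCommGroup K] [InnerProductSpace ℂ K]
variable {e : ∀ i, G i →ₗᵢ[ℂ] K} (he : ∀ i j h x, e j (f i j h x) = e i x)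
  (hd : Dense (⋃ i, Set.range (e i)))
include he hd

/-- A uniformly bounded compatible family of operators on the components extends to the limit. -/
theorem exists_directLimit_lift {L : Type*} [NormedAddCommGroup L] [NormedSpace ℂ L]
    [CompleteSpace L] (g : ∀ i, G i →L[ℂ] L) (hg : ∀ i j h x, g j (f i j h x) = g i x)
    (C : ℝ) (hC : ∀ i x, ‖g i x‖ ≤ C * ‖x‖) :
    ∃ T : K →L[ℂ] L, ∀ i x, T (e i x) = g i x := by
  let e' : DirectLimit G f →ₗ[ℂ] K :=
    DirectLimit.Module.lift ℂ ι G f (fun i => (e i).toLinearMap) he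
  let g' : DirectLimit G f →ₗ[ℂ] L :=
    DirectLimit.Module.lift ℂ ι G f (fun i => (g i).toLinearMap) hg
  have hdense : DenseRange e' := by
    refine hd.mono (Set.iUnion_subset fun i => ?_)
    rintro _ ⟨x, rfl⟩
    exact ⟨DirectLimit.Module.of ℂ ι G f i x, rfl⟩
  have hb : ∀ z, ‖g' z‖ ≤ C * ‖e' z‖ := DirectLimit.induction f fun i x => by
    change ‖g i x‖ ≤ C * ‖e i x‖
    rw [(e i).norm_map]
    exact hC i x
  exact ⟨g'.extendOfNorm e', fun i x =>
    LinearMap.extendOfNorm_eq hdense ⟨C, hb⟩ (DirectLimit.Module.of ℂ ι G f i x)⟩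

end HilbertDirectLimit

section DenseUnion

variable {ι : Type*} {G : ι → Type*} [∀ i, NormedAddCommGroup (G i)]
  [∀ i, InnerProductSpace ℂ (G i)]
variable {K : Type*} [NormedAddCommGroup K] [InnerProductSpace ℂ K]
variable {e : ∀ i, G i →ₗᵢ[ℂ] K} (hd : Dense (⋃ i, Set.range (e i)))
include hd

lemma clm_ext_of_dense_iUnion {L : Type*} [NormedAddCommGroup L] [NormedSpace ℂ L]
    {S T : K →L[ℂ] L} (h : ∀ i x, S (e i x) = T (e i x)) : S = T := by
  refine ContinuousLinearMap.ext fun z => ?_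
  refine congrFun (Continuous.ext_on hd S.continuous T.continuous ?_) z
  rintro _ hz
  obtain ⟨i, x, rfl⟩ := Set.mem_iUnion.mp hz
  exact h i x

lemma eq_top_of_dense_iUnion {M : Submodule ℂ K} (hM : IsClosed (M : Set K))
    (h : ∀ i x, e i x ∈ M) : M = ⊤ := by
  refine eq_top_iff.mpr fun k _ => hM.closure_subset_iff.mpr (Set.iUnion_subset fun i => ?_) (hd k)
  rintro _ ⟨x, rfl⟩
  exact h i x

end DenseUnion

/-! ### Isometric representations -/

section Contractive

open HilbertModule Correspondence

variable {A : Type*} [CStarAlgebra A] [PartialOrder A] [StarOrderedRing A]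
variable {E : Type*} [NormedAddCommGroup E] [NormedSpace ℂ E] [HilbertModule A E]
variable {K : Type*} [NormedAddCommGroup K] [InnerProductSpace ℂ K] [CompleteSpace K]

/-- An isometric representation is completely contractive: `V(x)⋆V(x)` is the image of the Gram
matrix of `x` under an amplification of `σ`. -/
lemma IsIsometricRep.completelyContractive {σ : A →⋆ₙₐ[ℂ] (K →L[ℂ] K)}
    {V : E →ₗ[ℂ] (K →L[ℂ] K)} (hV : IsIsometricRep σ V) (n : ℕ) (x : Fin n → Fin n → E) :
    ‖CStarMatrix.ofMatrix (Matrix.of fun i j => V (x i j))‖ ^ 2 ≤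
      ‖CStarMatrix.ofMatrix (Matrix.of fun i j => ∑ k, ip (A := A) (x k i) (x k j))‖ := by
  rw [pow_two, ← CStarRing.norm_star_mul_self]
  have h1 : star (CStarMatrix.ofMatrix (Matrix.of fun i j => V (x i j))) *
      CStarMatrix.ofMatrix (Matrix.of fun i j => V (x i j)) =
      CStarMatrix.mapₙₐ σ
        (CStarMatrix.ofMatrix (Matrix.of fun i j => ∑ k, ip (A := A) (x k i) (x k j))) := by
    ext1 i j
    change ∑ k, star (V (x k i)) * V (x k j) = σ (∑ k, ip (x k i) (x k j))
    rw [map_sum]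
    exact Finset.sum_congr rfl fun k _ => hV (x k i) (x k j)
  rw [h1]
  exact NonUnitalStarAlgHom.norm_apply_le _ _

end Contractive

/-! ### Products of tensors in a product system -/

section ProductSystem

open HilbertModule Correspondence

variable {A : Type u} [CStarAlgebra A] [PartialOrder A] {S : Type*}
    [AddCommMonoid S] {X : S → Type v} [∀ s, NormedAddCommGroup (X s)]
    [∀ s, NormedSpace ℂ (X s)] [∀ s, Correspondence A (X s)]

namespace Multiplication

variable (P : Multiplication A X)

/-- The product `X s × X r → X t` for an equality `s + r = t`, which need not hold by definition. -/
def mulOf {s r t : S} (h : s + r = t) : X s →ₗ[ℂ] X r →ₗ[ℂ] X t := h ▸ P.mul s r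

lemma mulOf_rfl (s r : S) : P.mulOf (rfl : s + r = s + r) = P.mul s r := rfl

lemma sigma_mk_mulOf {s r t : S} (h : s + r = t) (x : X s) (y : X r) :
    (⟨t, P.mulOf h x y⟩ : Σ s, X s) = ⟨s + r, P.mul s r x y⟩ := by
  subst h; rfl

lemma mulOf_mulOf {s t r a b c : S} (hst : s + t = a) (har : a + r = b) (htr : t + r = c)
    (hsc : s + c = b) (x : X s) (y : X t) (z : X r) :
    P.mulOf har (P.mulOf hst x y) z = P.mulOf hsc x (P.mulOf htr y z) := by
  subst hst htr
  refine sigma_mk_injective (i := b) ?_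
  rw [sigma_mk_mulOf, sigma_mk_mulOf]
  exact P.mul_assoc s t r x y z

lemma mulOf_unit_left {s : S} (h : 0 + s = s) (a : A) (x : X s) :
    P.mulOf h (P.unit a) x = left a x := by
  refine sigma_mk_injective (i := s) ?_
  rw [sigma_mk_mulOf]
  exact P.unit_mul s a x

lemma mulOf_unit_right {s : S} (h : s + 0 = s) (x : X s) (a : A) :
    P.mulOf h x (P.unit a) = x <• a := by
  refine sigma_mk_injective (i := s) ?_
  rw [sigma_mk_mulOf]
  exact P.mul_unit s x a

/-- Multiplication by `X 0` preserves inner products automatically, so that the condition on the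
products is only needed for `s, r ≠ 0`. -/
lemma preservesTensor_mulOf
    (hP : ∀ s t : S, s ≠ 0 → t ≠ 0 → PreservesTensor A (P.mul s t)) {s r t : S} (h : s + r = t) :
    PreservesTensor A (P.mulOf h) := by
  rcases eq_or_ne s 0 with rfl | hs
  · obtain rfl : r = t := by rw [← h, zero_add]
    refine ⟨fun x x' y y' => ?_, fun a x y => ?_, fun x y a => ?_⟩
    · obtain ⟨a, rfl⟩ := P.unit.surjective x
      obtain ⟨b, rfl⟩ := P.unit.surjective x'
      rw [mulOf_unit_left, mulOf_unit_left, P.ip_unit, ip_left, map_mul, Module.End.mul_apply]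
    · obtain ⟨b, rfl⟩ := P.unit.surjective x
      rw [mulOf_unit_left, P.left_unit, mulOf_unit_left, map_mul, Module.End.mul_apply]
    · obtain ⟨b, rfl⟩ := P.unit.surjective x
      rw [mulOf_unit_left, mulOf_unit_left]
      refine ext_ip (A := A) fun z => ?_
      rw [ip_rsmul, ← star_star b, ← ip_left, ← ip_left, ip_rsmul]
  rcases eq_or_ne r 0 with rfl | hr
  · obtain rfl : s = t := by rw [← h, add_zero]
    refine ⟨fun x x' y y' => ?_, fun a x y => ?_, fun x y a => ?_⟩
    · obtain ⟨a, rfl⟩ := P.unit.surjective y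
      obtain ⟨b, rfl⟩ := P.unit.surjective y'
      rw [mulOf_unit_right, mulOf_unit_right, P.left_unit, P.ip_unit, ip_rsmul, ip_rsmul_left,
        _root_.mul_assoc]
    · obtain ⟨b, rfl⟩ := P.unit.surjective y
      rw [mulOf_unit_right, mulOf_unit_right]
      refine ext_ip (A := A) fun z => ?_
      rw [ip_rsmul, ← star_star a, ← ip_left, ← ip_left, ip_rsmul]
    · obtain ⟨b, rfl⟩ := P.unit.surjective y
      rw [P.unit_rsmul, mulOf_unit_right, mulOf_unit_right, MulOpposite.op_mul, mul_smul]
  · subst h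
    exact hP s r hs hr

end Multiplication

variable [StarOrderedRing A]
variable {H : Type*} [NormedAddCommGroup H] [InnerProductSpace ℂ H] [CompleteSpace H]

namespace Representation

variable {P : Multiplication A X} (R : Representation P H)

open HilbertTensor

lemma T_mulOf {s r t : S} (h : s + r = t) (x : X s) (y : X r) :
    R.T t (P.mulOf h x y) = R.T s x ∘L R.T r y := by
  subst h; exact R.map_mul s r x y

/-- The operator `y ⊗ k ↦ xy ⊗ k` from `X r ⊗_σ H` to `X t ⊗_σ H`, for `x ∈ X s` and
`s + r = t`. -/
noncomputable def creation {s r t : S} (h : s + r = t) (x : X s) :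
    HilbertTensor R.σ (X r) →L[ℂ] HilbertTensor R.σ (X t) :=
  amplify R.σ (P.mulOf h x)

variable (h1 : ∀ (s : S) (x : X s), left (1 : A) x = x)
  (hm : ∀ (s r t : S) (h : s + r = t), PreservesTensor A (P.mulOf h))
include h1 hm

lemma creation_tmul {s r t : S} (h : s + r = t) (x : X s) (y : X r) (k : H) :
    R.creation h x (tmul R.σ y k) = tmul R.σ (P.mulOf h x y) k :=
  amplify_mul_tmul (hm s r t h) (h1 r) x y k

lemma inner_creation {s r t : S} (h : s + r = t) (x x' : X s) (ζ ζ' : HilbertTensor R.σ (X r)) :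
    inner ℂ (R.creation h x ζ) (R.creation h x' ζ') =
      inner ℂ ζ (leftAction R.σ (X r) (h1 r) (ip x x') ζ') :=
  inner_amplify_mul (hm s r t h) (h1 r) x x' ζ ζ'

lemma norm_creation_le {s r t : S} (h : s + r = t) (x : X s) (ζ : HilbertTensor R.σ (X r)) :
    ‖R.creation h x ζ‖ ≤ ‖x‖ * ‖ζ‖ := by
  refine le_of_sq_le_sq ?_ (by positivity)
  rw [← inner_self_eq_norm_sq (𝕜 := ℂ), R.inner_creation h1 hm, mul_pow, norm_sq_eq (A := A)]
  calc _ ≤ ‖(inner ℂ ζ (leftAction R.σ (X r) (h1 r) (ip x x) ζ) : ℂ)‖ := Complex.re_le_norm _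
    _ ≤ ‖ζ‖ * ‖leftAction R.σ (X r) (h1 r) (ip x x) ζ‖ := norm_inner_le_norm _ _
    _ ≤ ‖ζ‖ * (‖(ip x x : A)‖ * ‖ζ‖) := by
      gcongr
      exact (ContinuousLinearMap.le_opNorm _ _).trans
        (by gcongr; exact NonUnitalStarAlgHom.norm_apply_le _ _)
    _ = _ := by ring

lemma creation_add {s r t : S} (h : s + r = t) (x x' : X s) :
    R.creation h (x + x') = R.creation h x + R.creation h x' :=
  clm_ext fun y k => by
    simp only [add_apply, R.creation_tmul h1 hm, map_add, LinearMap.add_apply]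
    exact (HilbertTensor.mk R.σ).map_add₂ _ _ _

lemma creation_smul {s r t : S} (h : s + r = t) (c : ℂ) (x : X s) :
    R.creation h (c • x) = c • R.creation h x :=
  clm_ext fun y k => by
    simp only [smul_apply, R.creation_tmul h1 hm, map_smul, LinearMap.smul_apply]
    exact (HilbertTensor.mk R.σ).map_smul₂ _ _ _

lemma creation_mulOf {s t r a b c : S} (hst : s + t = a) (har : a + r = b) (htr : t + r = c)
    (hsc : s + c = b) (x : X s) (y : X t) (ζ : HilbertTensor R.σ (X r)) :
    R.creation har (P.mulOf hst x y) ζ = R.creation hsc x (R.creation htr y ζ) := by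
  have : R.creation har (P.mulOf hst x y) = R.creation hsc x ∘L R.creation htr y :=
    clm_ext fun z k => by
      rw [ContinuousLinearMap.comp_apply, R.creation_tmul h1 hm, R.creation_tmul h1 hm,
        R.creation_tmul h1 hm, P.mulOf_mulOf hst har htr hsc]
  rw [this, ContinuousLinearMap.comp_apply]

lemma creation_unit {s : S} (h : 0 + s = s) (a : A) :
    R.creation h (P.unit a) = leftAction R.σ (X s) (h1 s) a :=
  clm_ext fun y k => by
    rw [R.creation_tmul h1 hm, leftAction_tmul, P.mulOf_unit_left]

omit hm h1

/-- The coisometry `X s ⊗_σ H → H`, `x ⊗ k ↦ T_s(x) k`, of a fully coisometric representation. -/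
noncomputable def coisometry (hR : R.IsFullyCoisometric) (s : S) :
    HilbertTensor R.σ (X s) →L[ℂ] H := (hR s).choose

variable (hR : R.IsFullyCoisometric)

lemma coisometry_tmul (s : S) (x : X s) (k : H) :
    R.coisometry hR s (tmul R.σ x k) = R.T s x k := (hR s).choose_spec.1 x k

lemma coisometry_adjoint_apply (s : S) (k : H) :
    R.coisometry hR s (ContinuousLinearMap.adjoint (R.coisometry hR s) k) = k :=
  congrArg (fun f => f k) (hR s).choose_spec.2

lemma norm_adjoint_coisometry (s : S) (k : H) :
    ‖ContinuousLinearMap.adjoint (R.coisometry hR s) k‖ = ‖k‖ := by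
  rw [← sq_eq_sq₀ (norm_nonneg _) (norm_nonneg _), ← inner_self_eq_norm_sq (𝕜 := ℂ),
    ContinuousLinearMap.adjoint_inner_left, coisometry_adjoint_apply, inner_self_eq_norm_sq]

/-- A vector whose norm is preserved by the coisometry lies in its initial space. -/
lemma eq_adjoint_coisometry {s : S} {k : H} {ζ : HilbertTensor R.σ (X s)}
    (hζ : R.coisometry hR s ζ = k) (hn : ‖ζ‖ = ‖k‖) :
    ζ = ContinuousLinearMap.adjoint (R.coisometry hR s) k := by
  rw [← sub_eq_zero, ← norm_eq_zero, ← sq_eq_zero_iff, @norm_sub_sq ℂ,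
    ContinuousLinearMap.adjoint_inner_right, hζ, norm_adjoint_coisometry, hn,
    inner_self_eq_norm_sq (𝕜 := ℂ)]
  ring

lemma adjoint_coisometry_zero (hσ : R.σ 1 = 1) (k : H) :
    ContinuousLinearMap.adjoint (R.coisometry hR 0) k = tmul R.σ (P.unit 1) k := by
  have h1 : R.σ 1 k = k := by rw [hσ]; rfl
  refine (R.eq_adjoint_coisometry hR ?_ ?_).symm
  · rw [coisometry_tmul, R.T_unit, h1]
  · rw [← sq_eq_sq₀ (norm_nonneg _) (norm_nonneg _), ← inner_self_eq_norm_sq (𝕜 := ℂ), inner_tmul,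
      P.ip_unit, star_one, one_mul, h1, inner_self_eq_norm_sq (𝕜 := ℂ)]

lemma coisometry_leftAction (h1 : ∀ (s : S) (x : X s), left (1 : A) x = x) (s : S) (a : A)
    (ζ : HilbertTensor R.σ (X s)) :
    R.coisometry hR s (leftAction R.σ (X s) (h1 s) a ζ) = R.σ a (R.coisometry hR s ζ) := by
  have : R.coisometry hR s ∘L leftAction R.σ (X s) (h1 s) a = R.σ a ∘L R.coisometry hR s :=
    clm_ext fun x k => by
      rw [ContinuousLinearMap.comp_apply, ContinuousLinearMap.comp_apply, leftAction_tmul,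
        coisometry_tmul, coisometry_tmul, (R.isCCRep s).map_left, ContinuousLinearMap.comp_apply]
  exact congrArg (fun f => f ζ) this

lemma leftAction_adjoint_coisometry (h1 : ∀ (s : S) (x : X s), left (1 : A) x = x) (s : S) (a : A)
    (k : H) :
    leftAction R.σ (X s) (h1 s) a (ContinuousLinearMap.adjoint (R.coisometry hR s) k) =
      ContinuousLinearMap.adjoint (R.coisometry hR s) (R.σ a k) := by
  refine ext_inner_left ℂ fun ζ => ?_
  rw [ContinuousLinearMap.adjoint_inner_right, ← ContinuousLinearMap.adjoint_inner_left,
    ← ContinuousLinearMap.star_eq_adjoint, ← map_star, ContinuousLinearMap.adjoint_inner_right,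
    coisometry_leftAction, map_star, ContinuousLinearMap.star_eq_adjoint,
    ContinuousLinearMap.adjoint_inner_left]

include h1 hm

lemma coisometry_creation {s r t : S} (h : s + r = t) (x : X s) (ζ : HilbertTensor R.σ (X r)) :
    R.coisometry hR t (R.creation h x ζ) = R.T s x (R.coisometry hR r ζ) := by
  have : R.coisometry hR t ∘L R.creation h x = R.T s x ∘L R.coisometry hR r :=
    clm_ext fun y k => by
      rw [ContinuousLinearMap.comp_apply, ContinuousLinearMap.comp_apply, R.creation_tmul h1 hm,
        coisometry_tmul, coisometry_tmul, R.T_mulOf, ContinuousLinearMap.comp_apply]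
  exact congrArg (fun f => f ζ) this

/-- The isometry `1 ⊗ T̃_r⋆` from `X s ⊗_σ H` to `X s ⊗ X r ⊗_σ H ⊆ X t ⊗_σ H`, for
`s + r = t`. -/
lemma exists_transition {s r t : S} (h : s + r = t) :
    ∃ f : HilbertTensor R.σ (X s) →ₗᵢ[ℂ] HilbertTensor R.σ (X t), ∀ x k, f (tmul R.σ x k) =
      R.creation h x (ContinuousLinearMap.adjoint (R.coisometry hR r) k) := by
  refine exists_isometry (B := LinearMap.mk₂ ℂ
    (fun x k => R.creation h x (ContinuousLinearMap.adjoint (R.coisometry hR r) k))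
    (fun x x' k => ?_) (fun c x k => ?_) (fun x k k' => ?_) (fun c x k => ?_)) fun x x' k k' => ?_
  · rw [R.creation_add h1 hm]; rfl
  · rw [R.creation_smul h1 hm]; rfl
  · rw [map_add, map_add]
  · rw [map_smul, map_smul]
  · rw [LinearMap.mk₂_apply, LinearMap.mk₂_apply, R.inner_creation h1 hm,
      leftAction_adjoint_coisometry, ContinuousLinearMap.adjoint_inner_left,
      coisometry_adjoint_apply]

end Representation

end ProductSystem

/-! ### The directed system of the spaces `X s ⊗_σ H` -/

section Transition

open HilbertModule Correspondence HilbertTensor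

variable {A : Type u} [CStarAlgebra A] [PartialOrder A] [StarOrderedRing A]
variable {S : Type*} [AddCommMonoid S] [PartialOrder S] [IsOrderedCancelAddMonoid S]
  [CanonicallyOrderedAdd S]
variable {X : S → Type v} [∀ s, NormedAddCommGroup (X s)]
    [∀ s, NormedSpace ℂ (X s)] [∀ s, Correspondence A (X s)]
variable {H : Type*} [NormedAddCommGroup H] [InnerProductSpace ℂ H] [CompleteSpace H]

namespace Representation

variable {P : Multiplication A X} (R : Representation P H)
variable (h1 : ∀ (s : S) (x : X s), left (1 : A) x = x)
  (hm : ∀ (s r t : S) (h : s + r = t), PreservesTensor A (P.mulOf h))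
  (hR : R.IsFullyCoisometric)

/-- The isometry `X s ⊗_σ H → X t ⊗_σ H`, `x ⊗ k ↦ x ⊗ T̃_r⋆ k`, where `r = t - s`. -/
noncomputable def transition {s t : S} (hst : s ≤ t) :
    HilbertTensor R.σ (X s) →ₗᵢ[ℂ] HilbertTensor R.σ (X t) :=
  (R.exists_transition h1 hm hR (exists_add_of_le hst).choose_spec.symm).choose

lemma transition_tmul {s r t : S} (h : s + r = t) (hst : s ≤ t) (x : X s) (k : H) :
    R.transition h1 hm hR hst (tmul R.σ x k) =
      R.creation h x (ContinuousLinearMap.adjoint (R.coisometry hR r) k) := by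
  obtain rfl : r = (exists_add_of_le hst).choose :=
    add_left_cancel (h.trans (exists_add_of_le hst).choose_spec)
  exact (R.exists_transition h1 hm hR (exists_add_of_le hst).choose_spec.symm).choose_spec x k

lemma coisometry_transition {s t : S} (hst : s ≤ t) (ζ : HilbertTensor R.σ (X s)) :
    R.coisometry hR t (R.transition h1 hm hR hst ζ) = R.coisometry hR s ζ := by
  have : R.coisometry hR t ∘L (R.transition h1 hm hR hst).toContinuousLinearMap =
      R.coisometry hR s := clm_ext fun x k => by
    obtain ⟨r, hr⟩ := exists_add_of_le hst
    change R.coisometry hR t (R.transition h1 hm hR hst (tmul R.σ x k)) = _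
    rw [R.transition_tmul h1 hm hR hr.symm, R.coisometry_creation h1 hm,
      coisometry_adjoint_apply, coisometry_tmul]
  exact congrArg (fun f => f ζ) this

lemma transition_adjoint_coisometry {s t : S} (hst : s ≤ t) (k : H) :
    R.transition h1 hm hR hst (ContinuousLinearMap.adjoint (R.coisometry hR s) k) =
      ContinuousLinearMap.adjoint (R.coisometry hR t) k := by
  refine R.eq_adjoint_coisometry hR ?_ ?_
  · rw [coisometry_transition, coisometry_adjoint_apply]
  · rw [LinearIsometry.norm_map, norm_adjoint_coisometry]

lemma transition_creation {r s t s' t' : S} (h : r + s = t) (h' : r + s' = t') (hs : s ≤ s')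
    (ht : t ≤ t') (x : X r) (ζ : HilbertTensor R.σ (X s)) :
    R.transition h1 hm hR ht (R.creation h x ζ) =
      R.creation h' x (R.transition h1 hm hR hs ζ) := by
  have : (R.transition h1 hm hR ht).toContinuousLinearMap ∘L R.creation h x =
      R.creation h' x ∘L (R.transition h1 hm hR hs).toContinuousLinearMap :=
    clm_ext fun y k => by
      obtain ⟨q, hq⟩ := exists_add_of_le hs
      have hq' : t + q = t' := by rw [← h, ← h', hq, add_assoc]
      change R.transition h1 hm hR ht (R.creation h x (tmul R.σ y k)) =
        R.creation h' x (R.transition h1 hm hR hs (tmul R.σ y k))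
      rw [R.creation_tmul h1 hm, R.transition_tmul h1 hm hR hq',
        R.transition_tmul h1 hm hR hq.symm, R.creation_mulOf h1 hm h hq' hq.symm h']
  exact congrArg (fun f => f ζ) this

lemma transition_refl (hσ : R.σ 1 = 1) {s : S} (hs : s ≤ s) (ζ : HilbertTensor R.σ (X s)) :
    R.transition h1 hm hR hs ζ = ζ := by
  have : (R.transition h1 hm hR hs).toContinuousLinearMap =
      ContinuousLinearMap.id ℂ (HilbertTensor R.σ (X s)) := clm_ext fun x k => by
    change R.transition h1 hm hR hs (tmul R.σ x k) = tmul R.σ x k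
    rw [R.transition_tmul h1 hm hR (add_zero s), R.adjoint_coisometry_zero hR hσ,
      R.creation_tmul h1 hm, P.mulOf_unit_right, MulOpposite.op_one, one_smul]
  exact congrArg (fun f => f ζ) this

lemma transition_trans {s t t' : S} (hst : s ≤ t) (ht : t ≤ t') (hs : s ≤ t')
    (ζ : HilbertTensor R.σ (X s)) :
    R.transition h1 hm hR ht (R.transition h1 hm hR hst ζ) = R.transition h1 hm hR hs ζ := by
  have : (R.transition h1 hm hR ht).toContinuousLinearMap ∘L
      (R.transition h1 hm hR hst).toContinuousLinearMap =
      (R.transition h1 hm hR hs).toContinuousLinearMap := clm_ext fun x k => by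
    obtain ⟨r, hr⟩ := exists_add_of_le hst
    obtain ⟨q, hq⟩ := exists_add_of_le ht
    have hq' : s + (r + q) = t' := by rw [hq, hr, add_assoc]
    change R.transition h1 hm hR ht (R.transition h1 hm hR hst (tmul R.σ x k)) =
      R.transition h1 hm hR hs (tmul R.σ x k)
    rw [R.transition_tmul h1 hm hR hr.symm, R.transition_tmul h1 hm hR hq',
      R.transition_creation h1 hm hR hr.symm hq' le_self_add ht, transition_adjoint_coisometry]
  exact congrArg (fun f => f ζ) this

lemma directedSystem_transition (hσ : R.σ 1 = 1) :
    DirectedSystem (fun s => HilbertTensor R.σ (X s))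
      (fun _ _ h => R.transition h1 hm hR h) where
  map_self _ ζ := R.transition_refl h1 hm hR hσ le_rfl ζ
  map_map _ _ _ hij hjk ζ := R.transition_trans h1 hm hR hij hjk (hij.trans hjk) ζ

/-! ### The representation on the direct limit -/

section Limit

variable {K : Type*} [NormedAddCommGroup K] [InnerProductSpace ℂ K] [CompleteSpace K]
  {e : ∀ s, HilbertTensor R.σ (X s) →ₗᵢ[ℂ] K}
  (he : ∀ s t (h : s ≤ t) ζ, e t (R.transition h1 hm hR h ζ) = e s ζ)
  (hd : Dense (⋃ s, Set.range (e s))) (hσ : R.σ 1 = 1)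

omit [IsOrderedCancelAddMonoid S] [CompleteSpace K] in
include he hd in
/-- To prove a closed relation on the limit, it suffices to consider two vectors of a common
component. -/
lemma limit_induction₂ {p : K → K → Prop} (hp : IsClosed {q : K × K | p q.1 q.2})
    (h : ∀ s ζ ζ', p (e s ζ) (e s ζ')) (z w : K) : p z w := by
  have hd' : DenseRange fun q : Σ s, HilbertTensor R.σ (X s) => e q.1 q.2 := by
    rwa [DenseRange, Set.range_sigma_eq_iUnion_range]
  refine isClosed_property2 hd' hp ?_ z w
  rintro ⟨s, ζ⟩ ⟨t, ζ'⟩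
  rw [← he s (s + t) le_self_add, ← he t (s + t) le_add_self]
  exact h _ _ _

include he hd hσ in
lemma exists_shift (r : S) (x : X r) : ∃ T : K →L[ℂ] K,
    ∀ s t (h : r + s = t) (ζ : HilbertTensor R.σ (X s)), T (e s ζ) = e t (R.creation h x ζ) := by
  have _ : IsDirectedOrder S := ⟨fun s t => ⟨s + t, le_self_add, le_add_self⟩⟩
  have _ := R.directedSystem_transition h1 hm hR hσ
  obtain ⟨T, hT⟩ := exists_directLimit_lift (f := fun s t h => R.transition h1 hm hR h) he hd
    (fun s => (e (r + s)).toContinuousLinearMap ∘L R.creation rfl x)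
    (fun s t h ζ => by
      change e (r + t) (R.creation rfl x (R.transition h1 hm hR h ζ)) =
        e (r + s) (R.creation rfl x ζ)
      rw [← R.transition_creation h1 hm hR rfl rfl h (add_le_add_right h r), he])
    ‖x‖ (fun s ζ => by
      change ‖e (r + s) (R.creation rfl x ζ)‖ ≤ _
      rw [LinearIsometry.norm_map]
      exact R.norm_creation_le h1 hm rfl x ζ)
  refine ⟨T, fun s t h ζ => ?_⟩
  subst h
  exact hT s ζ

/-- The operator on the limit that multiplies all tensors by `x ∈ X r` from the left. -/
noncomputable def shift (r : S) : X r →ₗ[ℂ] (K →L[ℂ] K) where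
  toFun x := (R.exists_shift h1 hm hR he hd hσ r x).choose
  map_add' x y := clm_ext_of_dense_iUnion hd fun s ζ => by
    rw [add_apply, (R.exists_shift h1 hm hR he hd hσ r (x + y)).choose_spec s _ rfl,
      (R.exists_shift h1 hm hR he hd hσ r x).choose_spec s _ rfl,
      (R.exists_shift h1 hm hR he hd hσ r y).choose_spec s _ rfl, R.creation_add h1 hm, add_apply,
      map_add]
  map_smul' c x := clm_ext_of_dense_iUnion hd fun s ζ => by
    rw [RingHom.id_apply, smul_apply,
      (R.exists_shift h1 hm hR he hd hσ r (c • x)).choose_spec s _ rfl,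
      (R.exists_shift h1 hm hR he hd hσ r x).choose_spec s _ rfl, R.creation_smul h1 hm,
      smul_apply, map_smul]

lemma shift_apply {r s t : S} (h : r + s = t) (x : X r) (ζ : HilbertTensor R.σ (X s)) :
    R.shift h1 hm hR he hd hσ r x (e s ζ) = e t (R.creation h x ζ) :=
  (R.exists_shift h1 hm hR he hd hσ r x).choose_spec s t h ζ

lemma shift_unit (s : S) (a : A) (ζ : HilbertTensor R.σ (X s)) :
    R.shift h1 hm hR he hd hσ 0 (P.unit a) (e s ζ) = e s (leftAction R.σ (X s) (h1 s) a ζ) := by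
  rw [R.shift_apply h1 hm hR he hd hσ (zero_add s), R.creation_unit h1 hm]

/-- The representation of `A` on the limit. -/
noncomputable def limitHom : A →⋆ₙₐ[ℂ] (K →L[ℂ] K) where
  toFun a := R.shift h1 hm hR he hd hσ 0 (P.unit a)
  map_smul' c a := by rw [map_smul, map_smul]; rfl
  map_zero' := by rw [map_zero, map_zero]
  map_add' a b := by rw [map_add, map_add]
  map_mul' a b := clm_ext_of_dense_iUnion hd fun s ζ => by
    rw [mul_apply_eq_comp, shift_unit, shift_unit, shift_unit, _root_.map_mul,
      mul_apply_eq_comp]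
  map_star' a := by
    rw [ContinuousLinearMap.star_eq_adjoint, ContinuousLinearMap.eq_adjoint_iff]
    refine R.limit_induction₂ h1 hm hR he hd (isClosed_eq (by fun_prop) (by fun_prop))
      fun s ζ ζ' => ?_
    rw [shift_unit, shift_unit, LinearIsometry.inner_map_map, LinearIsometry.inner_map_map,
      map_star, ContinuousLinearMap.star_eq_adjoint, ContinuousLinearMap.adjoint_inner_left]

lemma limitHom_apply (s : S) (a : A) (ζ : HilbertTensor R.σ (X s)) :
    R.limitHom h1 hm hR he hd hσ a (e s ζ) = e s (leftAction R.σ (X s) (h1 s) a ζ) :=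
  R.shift_unit h1 hm hR he hd hσ s a ζ

lemma limitHom_one : R.limitHom h1 hm hR he hd hσ 1 = 1 :=
  clm_ext_of_dense_iUnion hd fun s ζ => by
    have : leftAction R.σ (X s) (h1 s) 1 = ContinuousLinearMap.id ℂ _ := clm_ext fun x k => by
      rw [leftAction_tmul, h1]; rfl
    rw [limitHom_apply, this]; rfl

lemma isIsometricRep_shift (r : S) :
    IsIsometricRep (R.limitHom h1 hm hR he hd hσ) (R.shift h1 hm hR he hd hσ r) := by
  intro x y
  refine ContinuousLinearMap.ext fun w => ext_inner_left ℂ fun z => ?_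
  rw [ContinuousLinearMap.comp_apply, ContinuousLinearMap.adjoint_inner_right]
  refine R.limit_induction₂ h1 hm hR he hd (p := fun z w =>
    inner ℂ (R.shift h1 hm hR he hd hσ r x z) (R.shift h1 hm hR he hd hσ r y w) =
      inner ℂ z (R.limitHom h1 hm hR he hd hσ (ip x y) w))
    (isClosed_eq (by fun_prop) (by fun_prop)) (fun s ζ ζ' => ?_) z w
  rw [R.shift_apply h1 hm hR he hd hσ rfl, R.shift_apply h1 hm hR he hd hσ rfl, limitHom_apply,
    LinearIsometry.inner_map_map, LinearIsometry.inner_map_map, R.inner_creation h1 hm]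

/-- The representation of the product system on the limit. -/
noncomputable def limitRep : Representation P K where
  σ := R.limitHom h1 hm hR he hd hσ
  T := R.shift h1 hm hR he hd hσ
  T_unit _ := rfl
  isCCRep s :=
    { completelyContractive := (R.isIsometricRep_shift h1 hm hR he hd hσ s).completelyContractive
      nondegenerate := by
        refine eq_top_iff.mpr fun k _ => Submodule.le_topologicalClosure _ ?_
        exact Submodule.subset_span ⟨1, k, by rw [limitHom_one]; rfl⟩
      map_rsmul x a := clm_ext_of_dense_iUnion hd fun t ζ => by
        rw [ContinuousLinearMap.comp_apply, limitHom_apply,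
          R.shift_apply h1 hm hR he hd hσ rfl, R.shift_apply h1 hm hR he hd hσ rfl,
          ← R.creation_unit h1 hm (zero_add t), ← R.creation_mulOf h1 hm (add_zero s) rfl,
          P.mulOf_unit_right]
      map_left a x := clm_ext_of_dense_iUnion hd fun t ζ => by
        rw [ContinuousLinearMap.comp_apply,
          R.shift_apply h1 hm hR he hd hσ rfl, R.shift_apply h1 hm hR he hd hσ rfl,
          limitHom_apply, ← R.creation_unit h1 hm (zero_add (s + t)),
          ← R.creation_mulOf h1 hm (zero_add s) rfl, P.mulOf_unit_left] }
  map_mul s t x y := clm_ext_of_dense_iUnion hd fun r ζ => by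
    rw [ContinuousLinearMap.comp_apply, R.shift_apply h1 hm hR he hd hσ rfl,
      R.shift_apply h1 hm hR he hd hσ rfl,
      R.shift_apply h1 hm hR he hd hσ (add_assoc s t r).symm, ← P.mulOf_rfl,
      R.creation_mulOf h1 hm rfl rfl rfl]

lemma isIsometric_limitRep : (R.limitRep h1 hm hR he hd hσ).IsIsometric :=
  R.isIsometricRep_shift h1 hm hR he hd hσ

/-- If the products span dense subspaces, then `Ṽ_s` maps `X s ⊗_ρ K` onto `K`: the image is
closed, and it contains `X s ⊗ X t ⊗_σ H` for all `t`. -/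
lemma isFullyCoisometric_limitRep
    (hdense : ∀ (s r t : S) (h : s + r = t), (Submodule.span ℂ {ζ : HilbertTensor R.σ (X t) |
      ∃ x y k, ζ = tmul R.σ (P.mulOf h x y) k}).topologicalClosure = ⊤) :
    (R.limitRep h1 hm hR he hd hσ).IsFullyCoisometric := by
  intro s
  obtain ⟨U, hU⟩ := exists_isometry (σ := R.limitHom h1 hm hR he hd hσ)
    (B := (ContinuousLinearMap.coeLM ℂ).comp (R.shift h1 hm hR he hd hσ s))
    (fun x x' k k' => by
      change inner ℂ (R.shift h1 hm hR he hd hσ s x k) (R.shift h1 hm hR he hd hσ s x' k') = _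
      rw [← ContinuousLinearMap.adjoint_inner_right, ← ContinuousLinearMap.comp_apply,
        R.isIsometricRep_shift h1 hm hR he hd hσ s])
  set M : Submodule ℂ K := LinearMap.range U.toLinearMap with hM
  have hclosed : IsClosed (M : Set K) := by
    have : (M : Set K) = Set.range U := LinearMap.coe_range _
    rw [this]
    exact U.isometry.isClosedEmbedding.isClosed_range
  have hmem : ∀ t ζ, e t ζ ∈ M := by
    intro t ζ
    rw [← he t (s + t) le_add_self]
    generalize R.transition h1 hm hR le_add_self ζ = η
    have hN : M.comap (e (s + t)).toLinearMap = ⊤ := by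
      rw [eq_top_iff, ← hdense s t (s + t) rfl]
      refine Submodule.topologicalClosure_minimal _ (Submodule.span_le.mpr ?_)
        (hclosed.preimage (e (s + t)).continuous)
      rintro _ ⟨x, y, k, rfl⟩
      refine ⟨tmul _ x (e t (tmul R.σ y k)), ?_⟩
      change U (tmul _ x (e t (tmul R.σ y k))) = e (s + t) (tmul R.σ (P.mulOf rfl x y) k)
      rw [hU, ← R.creation_tmul h1 hm]
      exact R.shift_apply h1 hm hR he hd hσ rfl x _
    have : η ∈ M.comap (e (s + t)).toLinearMap := hN ▸ Submodule.mem_top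
    exact this
  have hsurj : ∀ k, ∃ ζ, U ζ = k := fun k => by
    have : k ∈ M := eq_top_of_dense_iUnion hd hclosed hmem ▸ Submodule.mem_top
    exact this
  refine ⟨U.toContinuousLinearMap, fun x k => hU x k, ContinuousLinearMap.ext fun k => ?_⟩
  obtain ⟨ζ, rfl⟩ := hsurj k
  refine ext_inner_left ℂ fun k' => ?_
  obtain ⟨ζ', rfl⟩ := hsurj k'
  change inner ℂ (U ζ') (U (ContinuousLinearMap.adjoint U.toContinuousLinearMap (U ζ))) =
    inner ℂ (U ζ') (U ζ)
  rw [LinearIsometry.inner_map_map, ContinuousLinearMap.adjoint_inner_right]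
  rfl

/-- The embedding of `H` in the limit, as the range of `T̃_0⋆` in `X 0 ⊗_σ H`. -/
noncomputable def limitEmbedding (e : ∀ s, HilbertTensor R.σ (X s) →ₗᵢ[ℂ] K) : H →ₗᵢ[ℂ] K :=
  (e 0).comp ⟨(ContinuousLinearMap.adjoint (R.coisometry hR 0)).toLinearMap,
    R.norm_adjoint_coisometry hR 0⟩

omit [CompleteSpace K] in
include he in
/-- For every `s`, the image of `H` in the limit is the range of `T̃_s⋆` in `X s ⊗_σ H`. -/
lemma limitEmbedding_eq (s : S) (k : H) :
    R.limitEmbedding hR e k = e s (ContinuousLinearMap.adjoint (R.coisometry hR s) k) := by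
  change e 0 (ContinuousLinearMap.adjoint (R.coisometry hR 0) k) = _
  rw [← he 0 s zero_le, transition_adjoint_coisometry]

include he in
lemma adjoint_limitEmbedding (s : S) (ζ : HilbertTensor R.σ (X s)) :
    ContinuousLinearMap.adjoint (R.limitEmbedding hR e).toContinuousLinearMap (e s ζ) =
      R.coisometry hR s ζ := by
  refine ext_inner_right ℂ fun k => ?_
  rw [ContinuousLinearMap.adjoint_inner_left]
  change inner ℂ (e s ζ) (R.limitEmbedding hR e k) = _
  rw [R.limitEmbedding_eq h1 hm hR he s, LinearIsometry.inner_map_map,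
    ContinuousLinearMap.adjoint_inner_right]

/-- `H` is coinvariant: `P_H V_r(x) = T_r(x) P_H`. -/
lemma adjoint_limitEmbedding_shift (r : S) (x : X r) (z : K) :
    ContinuousLinearMap.adjoint (R.limitEmbedding hR e).toContinuousLinearMap
        (R.shift h1 hm hR he hd hσ r x z) =
      R.T r x (ContinuousLinearMap.adjoint (R.limitEmbedding hR e).toContinuousLinearMap z) := by
  have : ContinuousLinearMap.adjoint (R.limitEmbedding hR e).toContinuousLinearMap ∘L
        R.shift h1 hm hR he hd hσ r x =
      R.T r x ∘L ContinuousLinearMap.adjoint (R.limitEmbedding hR e).toContinuousLinearMap :=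
    clm_ext_of_dense_iUnion hd fun s ζ => by
      rw [ContinuousLinearMap.comp_apply, ContinuousLinearMap.comp_apply,
        R.shift_apply h1 hm hR he hd hσ rfl, R.adjoint_limitEmbedding h1 hm hR he,
        R.adjoint_limitEmbedding h1 hm hR he, R.coisometry_creation h1 hm]
  exact congrArg (fun f => f z) this

lemma shift_limitEmbedding (s : S) (x : X s) (k : H) :
    R.shift h1 hm hR he hd hσ s x (R.limitEmbedding hR e k) = e s (tmul R.σ x k) := by
  rw [R.limitEmbedding_eq h1 hm hR he 0, R.shift_apply h1 hm hR he hd hσ (add_zero s),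
    ← R.transition_tmul h1 hm hR (add_zero s) le_rfl, R.transition_refl h1 hm hR hσ]

lemma isMinimal_limitRep :
    (R.limitRep h1 hm hR he hd hσ).IsMinimal (R.limitEmbedding hR e) := by
  intro M hM hu hV
  refine eq_top_of_dense_iUnion hd hM fun s ζ => ?_
  have hN : M.comap (e s).toLinearMap = ⊤ :=
    eq_top_of_tmul_mem (hM.preimage (e s).continuous) fun x k => by
      change e s (tmul R.σ x k) ∈ M
      rw [← R.shift_limitEmbedding h1 hm hR he hd hσ]
      exact hV s x _ (hu k)
  have : ζ ∈ M.comap (e s).toLinearMap := hN ▸ Submodule.mem_top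
  exact this

end Limit

end Representation

end Transition

/-! ### Normality of the limit representation -/

section Normal

open Filter Topology

variable {A : Type*} [CStarAlgebra A] [PartialOrder A] [StarOrderedRing A]
variable {K : Type*} [NormedAddCommGroup K] [InnerProductSpace ℂ K] [CompleteSpace K]

/-- Normality of a representation may be tested on a set of vectors that spans a dense subspace:
with `a - d = b_d⋆ b_d`, the vectors `k` for which `ρ(b_d) k → 0` form a closed subspace. -/
theorem isNormal_of_dense_span (ρ : A →⋆ₙₐ[ℂ] (K →L[ℂ] K)) (Z : Set K)
    (hZ : (Submodule.span ℂ Z).topologicalClosure = ⊤)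
    (h : ∀ (D : Set A) (a : A), D.Nonempty → DirectedOn (· ≤ ·) D → (∀ d ∈ D, IsSelfAdjoint d) →
      IsLUB D a → ∀ k ∈ Z,
        IsLUB ((fun d => (inner ℂ k (ρ d k)).re) '' D) (inner ℂ k (ρ a k)).re) :
    IsNormal ρ := by
  intro D a hne hdir hsa hlub k
  have hb : ∀ d : A, ∃ b : A, d ∈ D → a - d = star b * b := fun d => by
    by_cases hd : d ∈ D
    · obtain ⟨b, hb⟩ := CStarAlgebra.nonneg_iff_eq_star_mul_self.mp (sub_nonneg.mpr (hlub.1 hd))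
      exact ⟨b, fun _ => hb⟩
    · exact ⟨0, fun h => absurd h hd⟩
  choose b hb using hb
  have hq : ∀ d ∈ D, ∀ k, (inner ℂ k (ρ a k) : ℂ).re - (inner ℂ k (ρ d k) : ℂ).re =
      ‖ρ (b d) k‖ ^ 2 := fun d hd k => by
    rw [← inner_self_eq_norm_sq (𝕜 := ℂ), ← Complex.sub_re, ← inner_sub_right, ← sub_apply,
      ← map_sub, hb d hd, map_mul, map_star, mul_apply_eq_comp,
      ContinuousLinearMap.star_eq_adjoint, ContinuousLinearMap.adjoint_inner_right]
    rfl
  have hmono : ∀ d ∈ D, ∀ d' ∈ D, d ≤ d' → ∀ k, ‖ρ (b d') k‖ ≤ ‖ρ (b d) k‖ := by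
    intro d hd d' hd' hdd k
    refine le_of_sq_le_sq ?_ (norm_nonneg _)
    rw [← hq d hd, ← hq d' hd']
    obtain ⟨c, hc⟩ := CStarAlgebra.nonneg_iff_eq_star_mul_self.mp (sub_nonneg.mpr hdd)
    have : 0 ≤ (inner ℂ k (ρ d' k) : ℂ).re - (inner ℂ k (ρ d k) : ℂ).re := by
      rw [← Complex.sub_re, ← inner_sub_right, ← sub_apply, ← map_sub, hc, map_mul, map_star,
        mul_apply_eq_comp, ContinuousLinearMap.star_eq_adjoint,
        ContinuousLinearMap.adjoint_inner_right]
      exact inner_self_nonneg (𝕜 := ℂ)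
    linarith
  let N : Submodule ℂ K :=
    { carrier := {k | ∀ ε : ℝ, 0 < ε → ∃ d ∈ D, ‖ρ (b d) k‖ < ε}
      zero_mem' := fun ε hε => by
        obtain ⟨d, hd⟩ := hne
        exact ⟨d, hd, by simpa using hε⟩
      add_mem' := fun {k k'} hk hk' ε hε => by
        obtain ⟨d, hd, h1⟩ := hk (ε / 2) (by positivity)
        obtain ⟨d', hd', h2⟩ := hk' (ε / 2) (by positivity)
        obtain ⟨d'', hd'', h3, h4⟩ := hdir d hd d' hd'
        refine ⟨d'', hd'', ?_⟩
        rw [map_add]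
        calc _ ≤ ‖ρ (b d'') k‖ + ‖ρ (b d'') k'‖ := norm_add_le _ _
          _ < ε / 2 + ε / 2 := add_lt_add ((hmono d hd d'' hd'' h3 k).trans_lt h1)
              ((hmono d' hd' d'' hd'' h4 k').trans_lt h2)
          _ = ε := add_halves ε
      smul_mem' := fun c k hk ε hε => by
        obtain ⟨d, hd, h1⟩ := hk (ε / (‖c‖ + 1)) (by positivity)
        refine ⟨d, hd, ?_⟩
        rw [map_smul, norm_smul]
        calc _ ≤ (‖c‖ + 1) * ‖ρ (b d) k‖ := by gcongr; linarith
          _ < (‖c‖ + 1) * (ε / (‖c‖ + 1)) := by gcongr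
          _ = ε := by field_simp }
  have hNclosed : IsClosed (N : Set K) := by
    refine isClosed_of_closure_subset fun k hk ε hε => ?_
    obtain ⟨d₀, hd₀⟩ := hne
    set C : ℝ := ‖ρ (b d₀)‖ + 1 with hC
    have hCpos : 0 < C := by positivity
    obtain ⟨k', hk', hkk⟩ := Metric.mem_closure_iff.mp hk (ε / (2 * C)) (by positivity)
    obtain ⟨d, hd, h1⟩ := hk' (ε / 2) (by positivity)
    obtain ⟨d', hd', h2, h3⟩ := hdir d₀ hd₀ d hd
    refine ⟨d', hd', ?_⟩
    have h4 : ‖ρ (b d') (k - k')‖ ≤ C * (ε / (2 * C)) := by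
      refine (hmono d₀ hd₀ d' hd' h2 _).trans ((ContinuousLinearMap.le_opNorm _ _).trans ?_)
      rw [dist_eq_norm] at hkk
      exact mul_le_mul (by linarith) hkk.le (norm_nonneg _) hCpos.le
    calc ‖ρ (b d') k‖ = ‖ρ (b d') (k - k') + ρ (b d') k'‖ := by rw [← map_add, sub_add_cancel]
      _ ≤ ‖ρ (b d') (k - k')‖ + ‖ρ (b d') k'‖ := norm_add_le _ _
      _ < C * (ε / (2 * C)) + ε / 2 :=
        add_lt_add_of_le_of_lt h4 ((hmono d hd d' hd' h3 k').trans_lt h1)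
      _ = ε := by field_simp; norm_num
  have hZN : Z ⊆ N := by
    intro k hk ε hε
    obtain ⟨_, ⟨d, hd, rfl⟩, h1⟩ := (lt_isLUB_iff (h D a hne hdir hsa hlub k hk)).mp
      (sub_lt_self (inner ℂ k (ρ a k) : ℂ).re (show 0 < ε ^ 2 by positivity))
    refine ⟨d, hd, lt_of_pow_lt_pow_left₀ 2 hε.le ?_⟩
    rw [← hq d hd]
    linarith
  have hk : k ∈ N := by
    have h1 : (Submodule.span ℂ Z).topologicalClosure ≤ N :=
      Submodule.topologicalClosure_minimal _ (Submodule.span_le.mpr hZN) hNclosed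
    exact h1 (hZ ▸ Submodule.mem_top)
  constructor
  · rintro _ ⟨d, hd, rfl⟩
    have := hq d hd k
    have h1 : 0 ≤ ‖ρ (b d) k‖ ^ 2 := by positivity
    simp only
    linarith
  · intro c hc
    refine le_of_forall_pos_le_add fun ε hε => ?_
    obtain ⟨d, hd, h1⟩ := hk (√ε) (by positivity)
    have h2 := hq d hd k
    have h3 : (inner ℂ k (ρ d k) : ℂ).re ≤ c := hc ⟨d, hd, rfl⟩
    have h4 : ‖ρ (b d) k‖ ^ 2 < ε := by
      rw [← Real.sq_sqrt hε.le]
      gcongr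
    linarith

end Normal

section Limit

open HilbertModule Correspondence HilbertTensor

variable {A : Type u} [CStarAlgebra A] [PartialOrder A] [StarOrderedRing A]
variable {S : Type*} [AddCommMonoid S] [PartialOrder S] [IsOrderedCancelAddMonoid S]
  [CanonicallyOrderedAdd S]
variable {X : S → Type v} [∀ s, NormedAddCommGroup (X s)]
    [∀ s, NormedSpace ℂ (X s)] [∀ s, Correspondence A (X s)]
variable {H : Type*} [NormedAddCommGroup H] [InnerProductSpace ℂ H] [CompleteSpace H]

namespace Representation

variable {P : Multiplication A X} (R : Representation P H)
  (h1 : ∀ (s : S) (x : X s), left (1 : A) x = x)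
  (hm : ∀ (s r t : S) (h : s + r = t), PreservesTensor A (P.mulOf h))
  (hR : R.IsFullyCoisometric)
  {K : Type*} [NormedAddCommGroup K] [InnerProductSpace ℂ K] [CompleteSpace K]
  {e : ∀ s, HilbertTensor R.σ (X s) →ₗᵢ[ℂ] K}
  (he : ∀ s t (h : s ≤ t) ζ, e t (R.transition h1 hm hR h ζ) = e s ζ)
  (hd : Dense (⋃ s, Set.range (e s))) (hσ : R.σ 1 = 1)

/-- The representation of `A` on the limit is normal: on a vector `x ⊗ k` it is given by
`a ↦ ⟨k, σ(⟨x, a x⟩) k⟩`. -/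
lemma isNormal_limitHom (hX : ∀ s, IsWStarCorrespondence A (X s)) (hN : IsNormal R.σ) :
    IsNormal (R.limitHom h1 hm hR he hd hσ) := by
  refine isNormal_of_dense_span _ {z | ∃ s x k, z = e s (tmul R.σ x k)} ?_ ?_
  · refine eq_top_of_dense_iUnion hd (Submodule.isClosed_topologicalClosure _) fun s ζ => ?_
    have h : (Submodule.span ℂ {z | ∃ s x k, z = e s (tmul R.σ x k)}).topologicalClosure.comap
        (e s).toLinearMap = ⊤ :=
      eq_top_of_tmul_mem ((Submodule.isClosed_topologicalClosure _).preimage (e s).continuous)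
        fun x k => Submodule.le_topologicalClosure _ (Submodule.subset_span ⟨s, x, k, rfl⟩)
    have : ζ ∈ Submodule.comap (e s).toLinearMap _ := h ▸ Submodule.mem_top
    exact this
  · rintro D a hne hdir hsa hlub _ ⟨s, x, k, rfl⟩
    have key : ∀ a, (inner ℂ (e s (tmul R.σ x k))
        (R.limitHom h1 hm hR he hd hσ a (e s (tmul R.σ x k))) : ℂ) =
        inner ℂ k (R.σ (ip x (left a x)) k) := fun a => by
      rw [limitHom_apply, LinearIsometry.inner_map_map, leftAction_tmul, inner_tmul]
    have hsa' : ∀ d, IsSelfAdjoint d → IsSelfAdjoint (ip (A := A) x (left d x)) := fun d hd => by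
      rw [IsSelfAdjoint, star_ip, ip_left, hd.star_eq]
    have hmono : ∀ d ∈ D, ∀ d' ∈ D, d ≤ d' → ip (A := A) x (left d x) ≤ ip x (left d' x) := by
      intro d _ d' _ hdd
      obtain ⟨c, hc⟩ := CStarAlgebra.nonneg_iff_eq_star_mul_self.mp (sub_nonneg.mpr hdd)
      rw [← sub_nonneg, ← ip_sub_right, ← LinearMap.sub_apply, ← map_sub, hc, _root_.map_mul,
        Module.End.mul_apply, ← ip_left]
      exact ip_self_nonneg _
    simp only [key]
    have := hN ((fun d => ip (A := A) x (left d x)) '' D) (ip x (left a x)) (hne.image _)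
      (by
        rintro _ ⟨d, hd, rfl⟩ _ ⟨d', hd', rfl⟩
        obtain ⟨d'', hd'', h3, h4⟩ := hdir d hd d' hd'
        exact ⟨_, ⟨d'', hd'', rfl⟩, hmono d hd d'' hd'' h3, hmono d' hd' d'' hd'' h4⟩)
      (by rintro _ ⟨d, hd, rfl⟩; exact hsa' d (hsa d hd))
      ((hX s).normal D a hne hdir hsa hlub x) k
    rwa [Set.image_image] at this

end Representation

end Limit

/-! ### Density of products -/

section Density

open HilbertModule Correspondence HilbertTensor

variable {A : Type u} [CStarAlgebra A] [PartialOrder A] [StarOrderedRing A]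
variable {S : Type*} [AddCommMonoid S]
variable {X : S → Type v} [∀ s, NormedAddCommGroup (X s)]
    [∀ s, NormedSpace ℂ (X s)] [∀ s, Correspondence A (X s)]
variable {H : Type*} [NormedAddCommGroup H] [InnerProductSpace ℂ H] [CompleteSpace H]

/-- If the products span a norm-dense subspace, then so do the tensors `xy ⊗ k`. -/
lemma topologicalClosure_span_tmul_of_dense {E F G : Type*}
    [NormedAddCommGroup E] [NormedSpace ℂ E] [Correspondence A E]
    [NormedAddCommGroup F] [NormedSpace ℂ F] [Correspondence A F]
    [NormedAddCommGroup G] [NormedSpace ℂ G] [Correspondence A G]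
    (σ : A →⋆ₙₐ[ℂ] (H →L[ℂ] H)) {m : E →ₗ[ℂ] F →ₗ[ℂ] G}
    (hm : (productSpan m).topologicalClosure = ⊤) :
    (Submodule.span ℂ {ζ : HilbertTensor σ G |
      ∃ x y k, ζ = tmul σ (m x y) k}).topologicalClosure = ⊤ := by
  set M := (Submodule.span ℂ {ζ : HilbertTensor σ G |
      ∃ x y k, ζ = tmul σ (m x y) k}).topologicalClosure with hM
  have hclosed : IsClosed (M : Set (HilbertTensor σ G)) := Submodule.isClosed_topologicalClosure _
  refine eq_top_of_tmul_mem hclosed fun z k => ?_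
  let T : G →L[ℂ] HilbertTensor σ G := ((HilbertTensor.mk σ).flip k).mkContinuous ‖k‖ fun x => by
    rw [mul_comm]; exact norm_tmul_le σ x k
  have h1 : M.comap T.toLinearMap = ⊤ := by
    rw [eq_top_iff, ← hm]
    refine Submodule.topologicalClosure_minimal _ (Submodule.span_le.mpr ?_)
      (hclosed.preimage T.continuous)
    rintro _ ⟨x, y, rfl⟩
    exact Submodule.le_topologicalClosure _ (Submodule.subset_span ⟨x, y, k, rfl⟩)
  have : z ∈ M.comap T.toLinearMap := h1 ▸ Submodule.mem_top
  exact this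

/-- The same for products of W⋆-correspondences, which span a submodule with trivial annihilator. -/
lemma topologicalClosure_span_tmul_of_isSelfDualTensorProduct [WStarAlgebra A] {E F G : Type*}
    [NormedAddCommGroup E] [NormedSpace ℂ E] [Correspondence A E]
    [NormedAddCommGroup F] [NormedSpace ℂ F] [Correspondence A F]
    [NormedAddCommGroup G] [NormedSpace ℂ G] [Correspondence A G]
    (σ : A →⋆ₙₐ[ℂ] (H →L[ℂ] H)) (hσ : IsNormal σ) {m : E →ₗ[ℂ] F →ₗ[ℂ] G}
    (hm : IsSelfDualTensorProduct A m) (hG : IsWStarCorrespondence A G) :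
    (Submodule.span ℂ {ζ : HilbertTensor σ G |
      ∃ x y k, ζ = tmul σ (m x y) k}).topologicalClosure = ⊤ := by
  have hspan : ∀ z ∈ productSpan m, ∀ a : A, z <• a ∈ productSpan m := by
    intro z hz a
    refine Submodule.span_induction (p := fun z _ => z <• a ∈ productSpan m) ?_ ?_ ?_ ?_ hz
    · rintro _ ⟨x, y, rfl⟩
      rw [← hm.mul_rsmul]
      exact Submodule.subset_span ⟨x, y <• a, rfl⟩
    · rw [smul_zero]; exact zero_mem _
    · intro x y _ _ hx hy
      rw [smul_add]; exact add_mem hx hy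
    · intro c x _ hx
      rw [smul_rsmul]; exact Submodule.smul_mem _ c hx
  have hann : ∀ g : G, (∀ y ∈ productSpan m, ip (A := A) g y = 0) → g = 0 := by
    intro g hg
    refine (hm.existsUnique 0 (fun z z' a _ => ?_)).unique (fun z => (hg z z.2).symm) fun z => ?_
    · rw [zero_apply, zero_apply, zero_mul]
    · rw [zero_apply, ip_zero_left]
  rw [eq_top_iff, ← topologicalClosure_span_tmul_of_selfDual hG.selfDual _ hspan hann σ hσ]
  refine Submodule.topologicalClosure_minimal _ (Submodule.span_le.mpr ?_)
    (Submodule.isClosed_topologicalClosure _)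
  rintro _ ⟨z, hz, k, rfl⟩
  refine Submodule.le_topologicalClosure _ ?_
  refine Submodule.span_induction (p := fun z _ => tmul σ z k ∈ Submodule.span ℂ
    {ζ : HilbertTensor σ G | ∃ x y k, ζ = tmul σ (m x y) k}) ?_ ?_ ?_ ?_ hz
  · rintro _ ⟨x, y, rfl⟩
    exact Submodule.subset_span ⟨x, y, k, rfl⟩
  · rw [← mk_apply, map_zero]; exact zero_mem _
  · intro x y _ _ hx hy
    rw [← mk_apply, map_add]; exact add_mem hx hy
  · intro c x _ hx
    rw [← mk_apply, map_smul]; exact Submodule.smul_mem _ c hx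

/-- Multiplication by `X 0` is onto, so that density is only needed for `s, r ≠ 0`. -/
lemma Multiplication.topologicalClosure_span_tmul_mulOf (P : Multiplication A X)
    (h1 : ∀ (s : S) (x : X s), left (1 : A) x = x) (σ : A →⋆ₙₐ[ℂ] (H →L[ℂ] H))
    (hP : ∀ s t : S, s ≠ 0 → t ≠ 0 → (Submodule.span ℂ {ζ : HilbertTensor σ (X (s + t)) |
      ∃ x y k, ζ = tmul σ (P.mul s t x y) k}).topologicalClosure = ⊤)
    {s r t : S} (h : s + r = t) :
    (Submodule.span ℂ {ζ : HilbertTensor σ (X t) |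
      ∃ x y k, ζ = tmul σ (P.mulOf h x y) k}).topologicalClosure = ⊤ := by
  rcases eq_or_ne s 0 with rfl | hs
  · obtain rfl : r = t := by rw [← h, zero_add]
    rw [eq_top_iff, ← topologicalClosure_span_tmul]
    refine Submodule.topologicalClosure_mono (Submodule.span_mono ?_)
    rintro _ ⟨x, k, rfl⟩
    exact ⟨P.unit 1, x, k, by rw [mulOf_unit_left, h1]⟩
  rcases eq_or_ne r 0 with rfl | hr
  · obtain rfl : s = t := by rw [← h, add_zero]
    rw [eq_top_iff, ← topologicalClosure_span_tmul]
    refine Submodule.topologicalClosure_mono (Submodule.span_mono ?_)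
    rintro _ ⟨x, k, rfl⟩
    exact ⟨x, P.unit 1, k, by rw [mulOf_unit_right, MulOpposite.op_one, one_smul]⟩
  · subst h
    exact hP s r hs hr

end Density

end CStarCorr

/-! ### The dilation -/

theorem mainTheorem3 {k : ℕ} (S : AddSubmonoid (Fin k → ℝ)) (hS_nonneg : ∀ s ∈ S, 0 ≤ s)
    (hS_parts : ∀ s ∈ S, ∀ t ∈ S, (s - t) ⊔ 0 ∈ S ∧ (s - t) ⊔ 0 - (s - t) ∈ S)
    {A : Type u} [CStarAlgebra A] [PartialOrder A] [StarOrderedRing A]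
    {X : S → Type v} [∀ s, NormedAddCommGroup (X s)] [∀ s, NormedSpace ℂ (X s)]
    [∀ s, CStarCorr.Correspondence A (X s)]
    (P : CStarCorr.Multiplication A X)
    (hX_unital : ∀ (s : S) (x : X s), CStarCorr.Correspondence.left (1 : A) x = x)
    {H : Type w} [NormedAddCommGroup H] [InnerProductSpace ℂ H] [CompleteSpace H]
    (R : CStarCorr.Representation P H) (hσ : R.σ 1 = 1) (hR : R.IsFullyCoisometric)
    (hP : P.IsProductSystem ∨ (P.IsWStarProductSystem ∧ CStarCorr.IsNormal R.σ)) :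
    ∃ (K : Type (max v w)) (_ : NormedAddCommGroup K) (_ : InnerProductSpace ℂ K)
      (_ : CompleteSpace K) (u : H →ₗᵢ[ℂ] K) (V : CStarCorr.Representation P K),
      V.IsIsometric ∧ V.IsFullyCoisometric ∧ V.σ 1 = 1 ∧ V.IsMinimal u ∧
      (∀ a : A, Commute (CStarCorr.imageProjection u) (V.σ a)) ∧
      (∀ (a : A) (h : H), V.σ a (u h) = u (R.σ a h)) ∧
      (∀ (s : S) (x : X s) (h : H),
        CStarCorr.imageProjection u (V.T s x (u h)) = u (R.T s x h)) ∧
      (∀ (s : S) (x : X s), ∀ y ∈ (LinearMap.range u.toLinearMap)ᗮ,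
        CStarCorr.imageProjection u (V.T s x y) = 0) ∧
      (CStarCorr.IsNondegenerate R.σ →
        (∀ s : S, (Submodule.span ℂ {y : X s | ∃ (a : A) (x : X s),
          y = CStarCorr.Correspondence.left a x}).topologicalClosure = ⊤) →
        CStarCorr.IsNondegenerate V.σ) ∧
      (P.IsWStarProductSystem → CStarCorr.IsNormal R.σ → CStarCorr.IsNormal V.σ) := by
  open CStarCorr in
  -- the condition on positive parts says that the pointwise order of `S` is divisibility
  have _ : CanonicallyOrderedAdd S :=
    { exists_add_of_le := fun {s t} hst => by
        have hst' : (0 : Fin k → ℝ) ≤ t - s := sub_nonneg.mpr hst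
        have h := (hS_parts t t.2 s s.2).1
        rw [sup_of_le_left hst'] at h
        exact ⟨⟨_, h⟩, Subtype.ext (add_sub_cancel _ _).symm⟩
      le_self_add := fun s t => show (s : Fin k → ℝ) ≤ s + t from
        le_add_of_nonneg_right (hS_nonneg t t.2)
      le_add_self := fun s t => show (s : Fin k → ℝ) ≤ t + s from
        le_add_of_nonneg_left (hS_nonneg t t.2) }
  have hm : ∀ (s r t : S) (h : s + r = t), PreservesTensor A (P.mulOf h) := fun s r t h =>
    P.preservesTensor_mulOf (fun s t hs ht => by
      rcases hP with hP | ⟨hP, -⟩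
      · exact (hP s t hs ht).toPreservesTensor
      · exact (hP.tensor s t hs ht).toPreservesTensor) h
  have hdense : ∀ (s r t : S) (h : s + r = t),
      (Submodule.span ℂ {ζ : HilbertTensor R.σ (X t) |
        ∃ x y k, ζ = HilbertTensor.tmul R.σ (P.mulOf h x y) k}).topologicalClosure = ⊤ :=
    fun s r t h => P.topologicalClosure_span_tmul_mulOf hX_unital R.σ (fun s t hs ht => by
      rcases hP with hP | ⟨hP, hN⟩
      · exact topologicalClosure_span_tmul_of_dense R.σ (hP s t hs ht).dense
      · have _ := hP.wStarAlgebra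
        exact topologicalClosure_span_tmul_of_isSelfDualTensorProduct R.σ hN (hP.tensor s t hs ht)
          (hP.wStarCorrespondence _)) h
  have _ : IsDirectedOrder S := ⟨fun s t => ⟨s + t, le_self_add, le_add_self⟩⟩
  have _ := R.directedSystem_transition hX_unital hm hR hσ
  obtain ⟨K, _, _, _, e, he, hd⟩ :=
    exists_hilbert_directLimit (fun s t h => R.transition hX_unital hm hR (s := s) (t := t) h)
  set V := R.limitRep hX_unital hm hR he hd hσ with hV
  set u := R.limitEmbedding hR e with hu
  have hco : ∀ s x z, ContinuousLinearMap.adjoint u.toContinuousLinearMap (V.T s x z) =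
      R.T s x (ContinuousLinearMap.adjoint u.toContinuousLinearMap z) :=
    R.adjoint_limitEmbedding_shift hX_unital hm hR he hd hσ
  have hcoσ : ∀ a z, ContinuousLinearMap.adjoint u.toContinuousLinearMap (V.σ a z) =
      R.σ a (ContinuousLinearMap.adjoint u.toContinuousLinearMap z) := fun a z => by
    rw [← V.T_unit, hco, R.T_unit]
  have huu : ∀ h, ContinuousLinearMap.adjoint u.toContinuousLinearMap (u h) = h := fun h =>
    ext_inner_left ℂ fun h' => by
      rw [ContinuousLinearMap.adjoint_inner_right]
      exact u.inner_map_map h' h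
  -- `u⋆` intertwines the representations of `A`, hence so does `u`
  have hint : ∀ (a : A) (h : H), V.σ a (u h) = u (R.σ a h) := fun a h => by
    refine ext_inner_left ℂ fun z => ?_
    rw [← ContinuousLinearMap.adjoint_inner_left, ← ContinuousLinearMap.star_eq_adjoint,
      ← map_star]
    change inner ℂ _ (u.toContinuousLinearMap h) = inner ℂ _ (u.toContinuousLinearMap _)
    rw [← ContinuousLinearMap.adjoint_inner_left, ← ContinuousLinearMap.adjoint_inner_left, hcoσ,
      map_star, ContinuousLinearMap.star_eq_adjoint, ContinuousLinearMap.adjoint_inner_left]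
  have hone : V.σ 1 = 1 := R.limitHom_one hX_unital hm hR he hd hσ
  refine ⟨K, inferInstance, inferInstance, inferInstance, u, V,
    R.isIsometric_limitRep hX_unital hm hR he hd hσ,
    R.isFullyCoisometric_limitRep hX_unital hm hR he hd hσ hdense, hone,
    R.isMinimal_limitRep hX_unital hm hR he hd hσ, ?_, hint, ?_, ?_, ?_, ?_⟩
  · intro a
    refine ContinuousLinearMap.ext fun z => ?_
    change u (ContinuousLinearMap.adjoint u.toContinuousLinearMap (V.σ a z)) =
      V.σ a (u (ContinuousLinearMap.adjoint u.toContinuousLinearMap z))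
    rw [hcoσ, hint]
  · intro s x h
    change u (ContinuousLinearMap.adjoint u.toContinuousLinearMap (V.T s x (u h))) = _
    rw [hco, huu]
  · intro s x y hy
    have hy0 : ContinuousLinearMap.adjoint u.toContinuousLinearMap y = 0 :=
      ext_inner_left ℂ fun h => by
        rw [ContinuousLinearMap.adjoint_inner_right, inner_zero_right]
        exact hy _ ⟨h, rfl⟩
    change u (ContinuousLinearMap.adjoint u.toContinuousLinearMap (V.T s x y)) = 0
    rw [hco, hy0, map_zero, map_zero]
  · exact fun _ _ => (V.isCCRep 0).nondegenerate
  · exact fun hW hN => R.isNormal_limitHom hX_unital hm hR he hd hσ hW.wStarCorrespondence hN
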